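/- **Setting.** Let $\Omega\subset\mathbb R^d$ be open with $\mathcal L^d(\Omega)<\infty$. Let $f:\Omega\times\mathbb R^N\to[0,\infty)$ be continuous, with $f(x,\cdot)$ convex for every $x\in\Omega$. Assume that there are $M>0$ and a modulus of continuity $\omega$ (that is, $\omega(t)\to\omega(0)=0$ as $t\downarrow0$) such that for all $x,y\in\Omega$ and $z\in\mathbb R^N$ $$\tfrac1M(|z|-1)\le |f(x,z)|\le M(1+|z|),\qquad |f(x,z)-f(y,z)|\le\omega(|x-y|)(1+|z|).$$ Put $$f^\infty(x,z)=\lim_{x'\to x,\;t\to\infty}\frac{f(x',tz)}{t},\qquad f^*(x,z^*)=\sup_{z\in\mathbb R^N}\{z^*\cdot z-f(x,z)\}\in(-\infty,\infty].$$ (Under these assumptions the limit exists.) Let $\mathcal A$ be a linear partial differential operator of arbitrary finite order, with coefficients smooth in $\Omega$, from $\mathbb R^N$-valued to $\mathbb R^n$-valued functions. Let $\mathrm W^{\mathcal A,1}(\Omega)$ be the set of $u\in \mathrm L^1(\Omega;\mathbb R^N)$ with $\mathcal Au\in \mathrm L^1(\Omega;\mathbb R^n)$ in the sense of distributions. Fix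 $u_0\in \mathrm W^{\mathcal A,1}(\Omega)$ and put $\tau=\mathcal Au_0$. Let - $\ker\mathcal A=\{u\in \mathrm L^1(\Omega;\mathbb R^N):\mathcal Au=0\}$; - $\mathcal M(\Omega;\mathbb R^N)$ be the space of $\mathbb R^N$-valued Radon measures on $\Omega$ with finite mass, and $\ker_{\mathcal M}\mathcal A=\{\mu\in\mathcal M(\Omega;\mathbb R^N):\mathcal A\mu=0\text{ in the sense of distributions}\}$; - $D(\mathcal A^*)$ be the set of $w^*\in \mathrm L^\infty(\Omega;\mathbb R^n)$ for which there is $c>0$ with $|\langle w^*,\mathcal Au\rangle|\le c\|u\|_{\mathrm L^1}$ for all $u\in \mathrm W^{\mathcal A,1}(\Omega)$; for such $w^*$ let $\mathcal A^*w^*\in \mathrm L^\infty(\Omega;\mathbb R^N)$ be given by $\langle\mathcal A^*w^*,u\rangle=\langle w^*,\mathcal Au\rangle$ for all $u\in \mathrm W^{\mathcal A,1}(\Omega)$; - $\mathcal R[w^*]=\langle w^*,\tau\rangle-\int_\Omega f^*(x,\mathcal A^*w^*(x))\,\mathrm dx\in[-\infty,\infty)$ for $w^*\in D(\mathcal A^*)$.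 For $\mu\in\mathcal M(\Omega;\mathbb R^N)$ let $\mu=\frac{\mathrm d\mu}{\mathrm d\mathcal L^d}\mathcal L^d+\mu^s$ be its Radon–Nikodým decomposition with respect to $\mathcal L^d$, and let $$\langle\mu\rangle(\Omega)=\int_\Omega\sqrt{1+\Big|\frac{\mathrm d\mu}{\mathrm d\mathcal L^d}\Big|^2}\,\mathrm dx+|\mu^s|(\Omega).$$ A sequence $\mu_j$ converges to $\mu$ area-strictly if $\mu_j\overset{*}{\rightharpoonup}\mu$ (tested against functions in $C_0(\Omega)$) and $\langle\mu_j\rangle(\Omega)\to\langle\mu\rangle(\Omega)$. Finally, let $[\![\mu,\mathcal A^*w^*]\!]$ be the set of $\lambda\in\mathcal M(\Omega)=\mathcal M(\Omega;\mathbb R)$ for which there is a sequence $(u_j)\subset u_0+\ker\mathcal A$ such that $u_j\mathcal L^d\to\mu$ area-strictly and $(u_j\cdot\mathcal A^*w^*)\mathcal L^d\overset{*}{\rightharpoonup}\lambda$. **Theorem 4.3.** Let $\mu\in u_0+\ker_{\mathcal M}\mathcal A$, let $w^*\in D(\mathcal A^*)$ with $\mathcal R[w^*]>-\infty$, and let $\lambda\in[\![\mu,\mathcal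 A^*w^*]\!]$. Then $$\frac{\mathrm d\lambda}{\mathrm d|\mu|}(x)=\frac{\mathrm d\lambda}{\mathrm d|\mu^s|}(x)\le f^\infty\Big(x,\frac{\mathrm d\mu}{\mathrm d|\mu^s|}(x)\Big)\qquad\text{for }|\mu^s|\text{-a.e. }x\in\Omega,$$ and $$\frac{\mathrm d\lambda}{\mathrm d\mathcal L^d}(x)=\frac{\mathrm d\mu}{\mathrm d\mathcal L^d}(x)\cdot\mathcal A^*w^*(x)\qquad\text{for }\mathcal L^d\text{-a.e. }x\in\Omega.$$ -/

import Mathlib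

open MeasureTheory Filter Topology
open scoped RealInnerProductSpace ZeroAtInfty Distributions ContDiff ENNReal

noncomputable section

namespace LinearGrowth

/-- `ℝᵏ` with its Euclidean norm. -/
abbrev Eu (k : ℕ) : Type := EuclideanSpace ℝ (Fin k)

/-- Lebesgue measure on an open set `Ω ⊆ ℝᵈ`. -/
instance instMeasureSpaceOpens {d : ℕ} (Ω : TopologicalSpace.Opens (Eu d)) : MeasureSpace Ω :=
  Measure.Subtype.measureSpace

/-- `L¹(Ω; ℝᴺ)`. -/
abbrev L1 {d : ℕ} (Ω : TopologicalSpace.Opens (Eu d)) (N : ℕ) : Type :=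
  Lp (Eu N) 1 (volume : Measure Ω)

/-- `L^∞(Ω; ℝᴺ)`. -/
abbrev Linfty {d : ℕ} (Ω : TopologicalSpace.Opens (Eu d)) (N : ℕ) : Type :=
  Lp (Eu N) ∞ (volume : Measure Ω)

/-- `𝓜(Ω; ℝᴺ)`: the `ℝᴺ`-valued Borel measures on `Ω`. Being countably additive with values in a
finite-dimensional space, they have finite total variation, and they are Radon measures because
`Ω` is an open subset of `ℝᵈ`. The space `𝓜(Ω)` of real measures is `SignedMeasure Ω`. -/
abbrev VMeas {d : ℕ} (Ω : TopologicalSpace.Opens (Eu d)) (N : ℕ) : Type :=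
  VectorMeasure Ω (Eu N)

/-! ### Linear partial differential operators -/

/-- The iterated partial derivative `D^α φ = ∂₁^{α₁} ⋯ ∂_d^{α_d} φ`. -/
def multiDeriv {d : ℕ} {F : Type*} [NormedAddCommGroup F] [NormedSpace ℝ F]
    (α : Fin d → ℕ) (φ : Eu d → F) : Eu d → F :=
  (List.finRange d).foldr
    (fun i ψ => (fun η x => fderiv ℝ η x (EuclideanSpace.single i (1 : ℝ)))^[α i] ψ) φ

/-- A linear partial differential operator `𝒜 u = ∑_α A_α(x) D^α u` (a finite sum, of arbitrary
order) from `ℝᴺ`-valued to `ℝⁿ`-valued functions on `Ω`, with coefficients smooth in `Ω`. -/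
structure PDO {d : ℕ} (Ω : TopologicalSpace.Opens (Eu d)) (N n : ℕ) where
  /-- the multi-indices which occur -/
  idx : Finset (Fin d → ℕ)
  /-- the coefficients -/
  coeff : (Fin d → ℕ) → Eu d → (Eu N →L[ℝ] Eu n)
  smooth : ∀ α ∈ idx, ContDiffOn ℝ ∞ (coeff α) Ω

namespace PDO

variable {d N n : ℕ} {Ω : TopologicalSpace.Opens (Eu d)} (A : PDO Ω N n)

/-- The formal adjoint on test functions: `∑_α (-1)^{|α|} D^α (A_αᵀ φ)`. -/
def formalAdjoint (φ : 𝓓(Ω, Eu n)) (x : Eu d) : Eu N :=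
  ∑ α ∈ A.idx, (-1 : ℝ) ^ (∑ i, α i) •
    multiDeriv α (fun y => ContinuousLinearMap.adjoint (A.coeff α y) (φ y)) x

/-- `𝒜 u = g` in `Ω` in the sense of distributions, for `u, g ∈ L¹`. Thus `u ∈ W^{𝒜,1}(Ω)` iff
`A.Maps u g` for some (then unique) `g`. -/
def Maps (u : L1 Ω N) (g : L1 Ω n) : Prop :=
  ∀ φ : 𝓓(Ω, Eu n),
    ∫ x : Ω, ⟪u x, A.formalAdjoint φ x⟫ = ∫ x : Ω, ⟪g x, φ (x : Eu d)⟫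

/-- The affine space `u₀ + ker 𝒜 ⊆ L¹(Ω; ℝᴺ)`. -/
def affineKer (u₀ : L1 Ω N) : Set (L1 Ω N) :=
  {u | A.Maps (u - u₀) 0}

/-- `ker_𝓜 𝒜`: the measures `ν` with `𝒜 ν = 0` in `Ω` in the sense of distributions. -/
def kerM : Set (VMeas Ω N) :=
  {ν | ∀ φ : 𝓓(Ω, Eu n), (∫ᵛ x, A.formalAdjoint φ x ∂[innerSL ℝ; ν]) = 0}

/-- The affine space `u₀ + ker_𝓜 𝒜`. -/
def affineKerM (u₀ : L1 Ω N) : Set (VMeas Ω N) :=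
  {μ | μ - (volume : Measure Ω).withDensityᵥ u₀ ∈ A.kerM}

/-- The domain `D(𝒜*) ⊆ L^∞(Ω; ℝⁿ)` of the dual operator of `𝒜 : W^{𝒜,1}(Ω) ⊆ L¹ → L¹`. -/
def adjointDomain : Set (Linfty Ω n) :=
  {w | ∃ c > 0, ∀ (u : L1 Ω N) (g : L1 Ω n), A.Maps u g →
    |∫ x : Ω, ⟪w x, g x⟫| ≤ c * ‖u‖}

/-- `v = 𝒜* w`, that is `⟨w, 𝒜 u⟩ = ⟨v, u⟩` for all `u ∈ W^{𝒜,1}(Ω)`. -/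
def IsAdjoint (w : Linfty Ω n) (v : Linfty Ω N) : Prop :=
  ∀ (u : L1 Ω N) (g : L1 Ω n), A.Maps u g →
    ∫ x : Ω, ⟪w x, g x⟫ = ∫ x : Ω, ⟪v x, u x⟫

open Classical in
/-- The dual operator `𝒜*`. For `w ∈ D(𝒜*)` the function `𝒜* w ∈ L^∞(Ω; ℝᴺ)` with
`⟨w, 𝒜 u⟩ = ⟨𝒜* w, u⟩` on `W^{𝒜,1}(Ω)` exists since `L^∞ = (L¹)*`, and is unique because
`W^{𝒜,1}(Ω)`, which contains the test functions, is dense in `L¹`. -/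
def adjoint (w : Linfty Ω n) : Linfty Ω N :=
  if h : ∃ v, A.IsAdjoint w v then h.choose else 0

end PDO

/-! ### Integrands -/

section Integrands

variable {d N : ℕ} {Ω : TopologicalSpace.Opens (Eu d)}

/-- The assumptions on the integrand `f : Ω × ℝᴺ → [0, ∞)`. -/
structure IsIntegrand (f : Ω → Eu N → ℝ) : Prop where
  nonneg : ∀ x z, 0 ≤ f x z
  continuous : Continuous fun p : Ω × Eu N => f p.1 p.2
  convex : ∀ x, ConvexOn ℝ Set.univ (f x)
  /-- coercivity and linear growth -/
  growth : ∃ M > 0, ∀ x z, 1 / M * (‖z‖ - 1) ≤ |f x z| ∧ |f x z| ≤ M * (1 + ‖z‖)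
  /-- modulus of continuity in `x` -/
  modulus : ∃ m : ℝ → ℝ, Tendsto m (𝓝[≥] 0) (𝓝 0) ∧
    ∀ x y z, |f x z - f y z| ≤ m (dist x y) * (1 + ‖z‖)

/-- The Fenchel conjugate in the second variable, `f*(x, z*) = sup_z (z* · z - f(x, z))`. -/
def conjugate (f : Ω → Eu N → ℝ) (x : Ω) (zs : Eu N) : EReal :=
  ⨆ z : Eu N, ((⟪zs, z⟫ - f x z : ℝ) : EReal)

/-- The recession function `f^∞(x, z) = lim_{x' → x, t → ∞} f(x', t z) / t`. -/
def recession (f : Ω → Eu N → ℝ) (x : Ω) (z : Eu N) : ℝ :=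
  limUnder (𝓝 x ×ˢ (atTop : Filter ℝ)) fun p => f p.1 (p.2 • z) / p.2

/-- For the integrands considered here, the limit which defines `f^∞(x, z)` exists. -/
theorem tendsto_recession {f : Ω → Eu N → ℝ} (hf : IsIntegrand f) (x : Ω) (z : Eu N) :
    Tendsto (fun p : Ω × ℝ => f p.1 (p.2 • z) / p.2) (𝓝 x ×ˢ (atTop : Filter ℝ))
      (𝓝 (recession f x z)) := by
  obtain ⟨M, hM, hg⟩ := hf.growth
  obtain ⟨m, hm, hmod⟩ := hf.modulus
  -- difference quotients along the ray are monotone and bounded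
  let h : ℝ → ℝ := fun t => (f x ((max t 1) • z) - f x 0) / max t 1
  have hmono : Monotone h := by
    intro s t hst
    have h1 : (1 : ℝ) ≤ max s 1 := le_max_right _ _
    have h2 : max s 1 ≤ max t 1 := max_le_max hst le_rfl
    set a := max s 1
    set b := max t 1
    have ha : 0 < a := by linarith
    have hb : 0 < b := by linarith
    have hc := (hf.convex x).2 (Set.mem_univ (b • z)) (Set.mem_univ (0 : Eu N))
      (show 0 ≤ a / b by positivity)
      (show 0 ≤ 1 - a / b by rw [sub_nonneg, div_le_one hb]; exact h2) (by ring)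
    rw [smul_zero, add_zero, smul_smul, div_mul_cancel₀ _ hb.ne'] at hc
    simp only [smul_eq_mul] at hc
    change (f x (a • z) - f x 0) / a ≤ (f x (b • z) - f x 0) / b
    rw [div_le_div_iff₀ ha hb]
    have : b * f x (a • z) ≤ b * (a / b * f x (b • z) + (1 - a / b) * f x 0) :=
      mul_le_mul_of_nonneg_left hc hb.le
    have e : b * (a / b * f x (b • z) + (1 - a / b) * f x 0)
        = a * f x (b • z) + (b - a) * f x 0 := by
      field_simp
    rw [e] at this
    nlinarith
  have hbdd : BddAbove (Set.range h) := by
    refine ⟨M * (1 + ‖z‖), ?_⟩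
    rintro _ ⟨t, rfl⟩
    have h1 : (1 : ℝ) ≤ max t 1 := le_max_right _ _
    change (f x ((max t 1) • z) - f x 0) / max t 1 ≤ _
    set a := max t 1
    rw [div_le_iff₀ (by linarith)]
    have := (le_abs_self _).trans (hg x (a • z)).2
    rw [norm_smul, Real.norm_eq_abs, abs_of_pos (by linarith : 0 < a)] at this
    have h0 := hf.nonneg x 0
    nlinarith [mul_nonneg hM.le (sub_nonneg.2 h1)]
  have hl := tendsto_atTop_ciSup hmono hbdd
  set L := ⨆ t, h t
  have hinv : Tendsto (fun t : ℝ => f x 0 / t) atTop (𝓝 0) := tendsto_const_nhds.div_atTop tendsto_id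
  have hray : Tendsto (fun t : ℝ => f x (t • z) / t) atTop (𝓝 L) := by
    have := hl.add hinv
    rw [add_zero] at this
    refine this.congr' ?_
    filter_upwards [eventually_ge_atTop (1 : ℝ)] with t ht
    simp only [h, max_eq_left ht]
    field_simp
    ring
  have hd : Tendsto (fun y : Ω => m (dist y x)) (𝓝 x) (𝓝 0) := by
    refine hm.comp (tendsto_nhdsWithin_iff.2 ⟨?_, Eventually.of_forall fun _ => dist_nonneg⟩)
    exact (continuous_id.dist continuous_const).tendsto' _ _ (dist_self x)
  have hdiff : Tendsto (fun p : Ω × ℝ => f p.1 (p.2 • z) / p.2 - f x (p.2 • z) / p.2)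
      (𝓝 x ×ˢ (atTop : Filter ℝ)) (𝓝 0) := by
    have hb : Tendsto (fun p : Ω × ℝ => m (dist p.1 x) * (1 + ‖z‖))
        (𝓝 x ×ˢ (atTop : Filter ℝ)) (𝓝 0) := by
      simpa using (hd.comp tendsto_fst).mul_const (1 + ‖z‖)
    refine squeeze_zero_norm' ?_ hb
    filter_upwards [tendsto_snd.eventually (eventually_ge_atTop (1 : ℝ))] with p hp
    have hp0 : (0 : ℝ) < p.2 := by linarith
    have hk := hmod p.1 x (p.2 • z)
    rw [norm_smul, Real.norm_eq_abs, abs_of_pos hp0] at hk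
    have hm0 : 0 ≤ m (dist p.1 x) := by
      have := (abs_nonneg _).trans (hmod p.1 x 0)
      simpa using this
    rw [← sub_div, Real.norm_eq_abs, abs_div, abs_of_pos hp0, div_le_iff₀ hp0]
    refine hk.trans ?_
    nlinarith [mul_nonneg hm0 (sub_nonneg.2 hp)]
  refine tendsto_nhds_limUnder ⟨L, ?_⟩
  have := hdiff.add (hray.comp (tendsto_snd (f := 𝓝 x)))
  simpa using this

/-- The integral over `Ω` of an extended real function, `∫ g⁺ - ∫ g⁻`. -/
def eintegral (g : Ω → EReal) : EReal :=
  ((∫⁻ x : Ω, (g x).toENNReal : ℝ≥0∞) : EReal) - ((∫⁻ x : Ω, (-g x).toENNReal : ℝ≥0∞) : EReal)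

open Classical in
/-- The dual functional `𝓡[w] = ⟨w, τ⟩ - ∫_Ω f*(x, 𝒜* w(x)) dx` for `w ∈ D(𝒜*)`, and `-∞` for other
`w ∈ L^∞(Ω; ℝⁿ)`. -/
def dualFunctional {n : ℕ} (A : PDO Ω N n) (f : Ω → Eu N → ℝ) (τ : L1 Ω n) (w : Linfty Ω n) :
    EReal :=
  if w ∈ A.adjointDomain then
    ((∫ x : Ω, ⟪w x, τ x⟫ : ℝ) : EReal) - eintegral fun x => conjugate f x (A.adjoint w x)
  else ⊥

end Integrands

/-! ### Measures -/

section Measures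

variable {d N : ℕ} {Ω : TopologicalSpace.Opens (Eu d)}

/-- The `i`-th component of a vector measure. -/
def component (μ : VMeas Ω N) (i : Fin N) : SignedMeasure Ω :=
  μ.mapRange (EuclideanSpace.proj i : Eu N →L[ℝ] ℝ).toLinearMap.toAddMonoidHom
    (EuclideanSpace.proj i : Eu N →L[ℝ] ℝ).continuous

/-- The Radon-Nikodym derivative `dμ/dν : Ω → ℝᴺ` (the density of the part of `μ` which is absolutely
continuous with respect to `ν`), taken componentwise. -/
def density (μ : VMeas Ω N) (ν : Measure Ω) (x : Ω) : Eu N :=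
  WithLp.toLp 2 fun i => (component μ i).rnDeriv ν x

/-- The singular part in `μ = (dμ/d𝓛ᵈ) 𝓛ᵈ + μˢ`. -/
def singularPart (μ : VMeas Ω N) : VMeas Ω N :=
  μ - (volume : Measure Ω).withDensityᵥ (density μ volume)

/-- The value `⟨μ⟩(Ω) = ∫_Ω √(1 + |dμ/d𝓛ᵈ|²) dx + |μˢ|(Ω)` of the area functional. -/
def area (μ : VMeas Ω N) : ℝ≥0∞ :=
  (∫⁻ x : Ω, ENNReal.ofReal √(1 + ‖density μ volume x‖ ^ 2)) +
    (singularPart μ).variation Set.univ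

/-- Weak* convergence of (real or vector) measures on `Ω`: convergence of the integrals of all
functions in `C₀(Ω)`. -/
def WeakStar {F : Type*} [NormedAddCommGroup F] [NormedSpace ℝ F]
    (ν : ℕ → VectorMeasure Ω F) (μ : VectorMeasure Ω F) : Prop :=
  ∀ φ : C₀(Ω, ℝ), Tendsto (fun j => ∫ᵛ x, φ x ∂•(ν j)) atTop (𝓝 (∫ᵛ x, φ x ∂•μ))

/-- Area-strict convergence. -/
def AreaStrict (ν : ℕ → VMeas Ω N) (μ : VMeas Ω N) : Prop :=
  WeakStar ν μ ∧ Tendsto (fun j => area (ν j)) atTop (𝓝 (area μ))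

/-- The generalized pairing `⟦μ, v⟧`: the weak* limits of `(u_j · v) 𝓛ᵈ` along sequences `(u_j)` in
`u₀ + ker 𝒜` such that `u_j 𝓛ᵈ` converges area-strictly to `μ`. -/
def pairing {n : ℕ} (A : PDO Ω N n) (u₀ : L1 Ω N) (μ : VMeas Ω N) (v : Linfty Ω N) :
    Set (SignedMeasure Ω) :=
  {lam | ∃ u : ℕ → L1 Ω N, (∀ j, u j ∈ A.affineKer u₀) ∧
    AreaStrict (fun j => (volume : Measure Ω).withDensityᵥ (u j)) μ ∧
    WeakStar (fun j => (volume : Measure Ω).withDensityᵥ fun x => ⟪u j x, v x⟫) lam}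

end Measures

end LinearGrowth

end

/-! Write `a` for the Lebesgue density of `μ`, `s` for the polar direction of its singular part
`μˢ`, and `v` for `𝒜* w`. Finiteness of the dual functional forces `f*(x, v(x)) < ∞` almost
everywhere. Dividing Fenchel's inequality along rays by `t → ∞` then gives `z · v(x) ≤ f^∞(x, z)`
for all `z` (`inner_le_recession`). The function `v` is merely bounded and measurable, so `u_j · v`
cannot be passed to the limit directly. It is compared with a continuous integrand instead. Let `G`
be positively homogeneous and Lipschitz in `z`, with `z · v ≤ G(x, z)`, and let `b` be continuous
with compact support. Then `u_j · v ≤ G(x, u_j - b) + b · v`. Area-strict convergence is strict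
convergence of the lifted measures `(u_j, 1) 𝓛ᵈ`, so Reshetnyak's theorem yields the limit of the
right-hand side. The shift disappears from the singular part, where the last coordinate of the lift
is `0`. Letting `b → a` in `L¹` gives `λ ≤ (a · v) 𝓛ᵈ + G(x, s) |μˢ|` (`le_of_areaStrict`,
`apply_le_of_areaStrict`). Without the shift the absolutely continuous term would be only `G(x, a)`.
The choice `G = f^∞` gives the upper bound on the singular part. The choice `G = D|z|`, with `D` a
bound for `|v|`, applied to `v` and to `-v`, gives `|λ - (a · v) 𝓛ᵈ| ≤ D |μˢ|`. Thus `λ - (a · v)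
𝓛ᵈ` is carried by `|μˢ|`, and both densities can be read off (`signedMeasure_rnDeriv_of_bounds`). -/

namespace LinearGrowth

/-! ### Reshetnyak's continuity theorem -/

section Reshetnyak

/-- Continuous functions `G(x, z)` which are positively `1`-homogeneous and `K`-Lipschitz in `z`. -/
structure IsHomogLipschitz {X F : Type*} [TopologicalSpace X] [NormedAddCommGroup F]
    [NormedSpace ℝ F] (K : ℝ) (G : X → F → ℝ) : Prop where
  continuous : Continuous fun p : X × F => G p.1 p.2
  smul : ∀ x (t : ℝ) z, 0 ≤ t → G x (t • z) = t * G x z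
  lipschitz : ∀ x z z', |G x z - G x z'| ≤ K * ‖z - z'‖

variable {X F : Type*} [MetricSpace X] [LocallyCompactSpace X] [SecondCountableTopology X]
  [MeasurableSpace X] [BorelSpace X] [NormedAddCommGroup F]

namespace IsHomogLipschitz

variable [NormedSpace ℝ F] {K : ℝ} {G : X → F → ℝ}

omit [LocallyCompactSpace X] [SecondCountableTopology X] [MeasurableSpace X] [BorelSpace X] in
theorem apply_zero (hG : IsHomogLipschitz K G) (x : X) : G x 0 = 0 := by
  simpa using hG.smul x 0 0 le_rfl

omit [LocallyCompactSpace X] [SecondCountableTopology X] [MeasurableSpace X] [BorelSpace X] in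
theorem abs_apply_le (hG : IsHomogLipschitz K G) (x : X) (z : F) : |G x z| ≤ K * ‖z‖ := by
  simpa [hG.apply_zero] using hG.lipschitz x z 0

omit [LocallyCompactSpace X] in
theorem integrable (hG : IsHomogLipschitz K G) {m : Measure X} {V : X → F} (hV : Integrable V m) :
    Integrable (fun x => G x (V x)) m := by
  refine (hV.norm.const_mul K).mono' ?_ (Eventually.of_forall fun x => hG.abs_apply_le x (V x))
  exact hG.continuous.comp_aestronglyMeasurable
    (continuous_id.aestronglyMeasurable.prodMk hV.aestronglyMeasurable)

end IsHomogLipschitz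

variable [InnerProductSpace ℝ F]

omit [LocallyCompactSpace X] [SecondCountableTopology X] [MeasurableSpace X] [BorelSpace X] in
-- If `p` almost points in the direction of `z`, then `z` is close to `‖z‖ • p`, where homogeneity
-- makes `G` explicit. The misalignment enters only through `‖z‖ - ⟪p, z⟫`; both `‖z‖` and `⟪p, z⟫`
-- have integrals that converge under strict convergence.
theorem IsHomogLipschitz.abs_sub_linearization_le {K : ℝ} {G : X → F → ℝ}
    (hG : IsHomogLipschitz K G) (hK : 0 ≤ K) (x : X) {δ : ℝ} (hδ : 0 < δ) {p z : F} (hp : ‖p‖ ≤ 1) :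
    |G x z - G x p * ⟪p, z⟫| ≤ K * (δ * ‖z‖ + (1 + 1 / (2 * δ)) * (‖z‖ - ⟪p, z⟫)) := by
  have hd : 0 ≤ ‖z‖ - ⟪p, z⟫ := by
    have := real_inner_le_norm p z
    nlinarith [norm_nonneg z]
  set e := ‖z‖ - ⟪p, z⟫ with he
  have h1 : ‖z - ‖z‖ • p‖ ^ 2 ≤ 2 * ‖z‖ * e := by
    rw [norm_sub_sq_real, norm_smul, norm_norm, inner_smul_right, real_inner_comm, he]
    have : ‖p‖ ^ 2 ≤ 1 := by nlinarith [norm_nonneg p]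
    nlinarith [mul_le_mul_of_nonneg_left this (sq_nonneg ‖z‖)]
  -- Young's inequality for `√(2‖z‖e)`; it makes the bound linear in `‖z‖` and `e`.
  have h2 : ‖z - ‖z‖ • p‖ ≤ δ * ‖z‖ + 1 / (2 * δ) * e := by
    refine abs_le_of_sq_le_sq' (h1.trans ?_) (by positivity) |>.2
    have : δ * (1 / (2 * δ)) = 1 / 2 := by field_simp
    nlinarith [sq_nonneg (δ * ‖z‖ - 1 / (2 * δ) * e), norm_nonneg z]
  have h3 := hG.lipschitz x z (‖z‖ • p)
  rw [hG.smul x _ _ (norm_nonneg z)] at h3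
  have h4 : |G x p * e| ≤ K * e := by
    rw [abs_mul, abs_of_nonneg hd]
    refine mul_le_mul_of_nonneg_right ((hG.abs_apply_le x p).trans ?_) hd
    nlinarith
  have h5 : G x z - G x p * ⟪p, z⟫ = (G x z - ‖z‖ * G x p) + G x p * e := by rw [he]; ring
  rw [h5]
  calc _ ≤ _ := abs_add_le _ _
    _ ≤ K * (δ * ‖z‖ + 1 / (2 * δ) * e) + K * e := by gcongr; exact h3.trans (by gcongr)
    _ = _ := by ring

/-- The direction `U/‖U‖` attains `⟪σ, U⟫ = ‖U‖`. It is approximated by compactly supported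
continuous fields in `L¹(‖U‖θ)`, the measure which weights the error correctly, and these fields are
then cut down to the unit ball. -/
theorem exists_compactlySupported_inner_approx {θ : Measure X} [IsFiniteMeasure θ] {U : X → F}
    (hU : Integrable U θ) {ε : ℝ} (hε : 0 < ε) :
    ∃ Ψ : X → F, Continuous Ψ ∧ HasCompactSupport Ψ ∧ (∀ x, ‖Ψ x‖ ≤ 1) ∧
      ∫ x, (‖U x‖ - ⟪Ψ x, U x⟫) ∂θ ≤ ε := by
  set m : Measure X := θ.withDensity fun x => ‖U x‖ₑ
  have : IsFiniteMeasure m := isFiniteMeasure_withDensity hU.2.ne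
  set σ : X → F := fun x => ‖U x‖⁻¹ • U x
  have hσ1 : ∀ x, ‖σ x‖ ≤ 1 := fun x => by
    simp only [σ, norm_smul, norm_inv, norm_norm]
    exact inv_mul_le_one
  have hσm : AEStronglyMeasurable σ θ :=
    (hU.1.norm.aemeasurable.inv.aestronglyMeasurable).smul hU.1
  have hσ : Integrable σ m := Integrable.of_bound
    (hσm.mono_ac (withDensity_absolutelyContinuous _ _)) 1 (Eventually.of_forall hσ1)
  obtain ⟨g, hgs, hg, hgc, hgi⟩ := hσ.exists_hasCompactSupport_integral_sub_le (half_pos hε)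
  -- Since `‖σ x‖ ≤ 1`, the radial retraction onto the unit ball moves `g x` by at most `‖σ x - g
  -- x‖`; hence the factor 2.
  have hpt : ∀ x, ‖U x‖ - ⟪(max 1 ‖g x‖)⁻¹ • g x, U x⟫ ≤ ‖U x‖ * (2 * ‖σ x - g x‖) := by
    intro x
    set c := max 1 ‖g x‖
    have hc : 1 ≤ c := le_max_left _ _
    have hc0 : 0 < c := by linarith
    have h1 : ⟪σ x, U x⟫ = ‖U x‖ := by
      simp only [σ, inner_smul_left, real_inner_self_eq_norm_sq]
      by_cases h0 : ‖U x‖ = 0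
      · simp [h0]
      · simp; field_simp
    have h2 : ‖g x - c⁻¹ • g x‖ ≤ ‖σ x - g x‖ := by
      have e : g x - c⁻¹ • g x = (1 - c⁻¹) • g x := by rw [sub_smul, one_smul]
      have hc1 : c⁻¹ ≤ 1 := inv_le_one_of_one_le₀ hc
      rw [e, norm_smul, Real.norm_of_nonneg (by linarith)]
      have h3 : ‖g x‖ - 1 ≤ ‖σ x - g x‖ := by
        have := norm_sub_norm_le (g x) (σ x)
        rw [norm_sub_rev] at this
        linarith [hσ1 x]
      rcases le_total ‖g x‖ 1 with h | h
      · have : c = 1 := max_eq_left h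
        simp [this]
      · have : c = ‖g x‖ := max_eq_right h
        rw [← this] at h3 ⊢
        have : (1 - c⁻¹) * c = c - 1 := by field_simp
        linarith
    have h4 : ‖U x‖ - ⟪c⁻¹ • g x, U x⟫ = ⟪(σ x - g x) + (g x - c⁻¹ • g x), U x⟫ := by
      rw [sub_add_sub_cancel, inner_sub_left, h1]
    rw [h4]
    refine (real_inner_le_norm _ _).trans ?_
    have := norm_add_le (σ x - g x) (g x - c⁻¹ • g x)
    nlinarith [norm_nonneg (U x)]
  have hcont : Continuous fun x => (max 1 ‖g x‖)⁻¹ • g x :=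
    ((continuous_const.max hgc.norm).inv₀ fun x =>
      (lt_of_lt_of_le one_pos (le_max_left _ _)).ne').smul hgc
  have hb : ∀ x, ‖(max 1 ‖g x‖)⁻¹ • g x‖ ≤ 1 := fun x => by
    have hc0 : 0 < max 1 ‖g x‖ := lt_of_lt_of_le one_pos (le_max_left _ _)
    rw [norm_smul, norm_inv, Real.norm_of_nonneg hc0.le, inv_mul_le_one₀ hc0]
    exact le_max_right _ _
  refine ⟨_, hcont, hgs.smul_left, hb, ?_⟩
  have hI : Integrable (fun x => ‖U x‖ * (2 * ‖σ x - g x‖)) θ := by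
    have := ((hσ.sub hgi).norm.const_mul 2)
    rw [integrable_withDensity_iff_integrable_smul₀' hU.1.enorm (by simp)] at this
    simpa using this
  calc _ ≤ ∫ x, ‖U x‖ * (2 * ‖σ x - g x‖) ∂θ := by
        refine integral_mono (hU.norm.sub ?_) hI hpt
        refine hU.norm.mono' (hcont.aestronglyMeasurable.inner hU.1)
          (Eventually.of_forall fun x => (norm_inner_le_norm _ _).trans ?_)
        exact mul_le_of_le_one_left (norm_nonneg _) (hb x)
    _ = 2 * ∫ x, ‖σ x - g x‖ ∂m := by
        rw [integral_withDensity_eq_integral_toReal_smul₀ hU.1.enorm (by simp),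
          ← integral_const_mul]
        refine integral_congr_ae (Eventually.of_forall fun x => ?_)
        simp only [toReal_enorm, smul_eq_mul]
        ring
    _ ≤ ε := by linarith

omit [LocallyCompactSpace X] in
theorem IsHomogLipschitz.abs_integral_sub_linearization_le {K C δ : ℝ} {G : X → F → ℝ}
    (hG : IsHomogLipschitz K G) (hK : 0 ≤ K) (hδ : 0 < δ) {φ : X → ℝ} (hφ : Continuous φ)
    (hφC : ∀ x, |φ x| ≤ C) {Ψ : X → F} (hΨ : Continuous Ψ) (hΨ1 : ∀ x, ‖Ψ x‖ ≤ 1)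
    {m : Measure X} {V : X → F} (hV : Integrable V m) :
    |∫ x, φ x * G x (V x) ∂m - ∫ x, ⟪(φ x * G x (Ψ x)) • Ψ x, V x⟫ ∂m| ≤
      C * K * (δ * ∫ x, ‖V x‖ ∂m + (1 + 1 / (2 * δ)) * (∫ x, ‖V x‖ ∂m - ∫ x, ⟪Ψ x, V x⟫ ∂m)) := by
  have hGΨ : Continuous fun x => G x (Ψ x) := hG.continuous.comp (continuous_id.prodMk hΨ)
  have hGΨK : ∀ x, |G x (Ψ x)| ≤ K := fun x =>
    (hG.abs_apply_le x (Ψ x)).trans (mul_le_of_le_one_right hK (hΨ1 x))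
  have hi1 : Integrable (fun x => φ x * G x (V x)) m :=
    (hG.integrable hV).bdd_mul hφ.aestronglyMeasurable (Eventually.of_forall hφC)
  have hi3 : Integrable (fun x => ⟪Ψ x, V x⟫) m := by
    refine hV.norm.mono' (hΨ.aestronglyMeasurable.inner hV.1)
      (Eventually.of_forall fun x => (norm_inner_le_norm _ _).trans ?_)
    exact mul_le_of_le_one_left (norm_nonneg _) (hΨ1 x)
  have hi2 : Integrable (fun x => ⟪(φ x * G x (Ψ x)) • Ψ x, V x⟫) m := by
    simp only [inner_smul_left]
    refine hi3.bdd_mul (c := C * K) (hφ.mul hGΨ).aestronglyMeasurable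
      (Eventually.of_forall fun x => ?_)
    simp only [conj_trivial, norm_mul, Real.norm_eq_abs]
    exact mul_le_mul (hφC x) (hGΨK x) (abs_nonneg _) ((abs_nonneg _).trans (hφC x))
  have hi4 : Integrable (fun x => ‖V x‖ - ⟪Ψ x, V x⟫) m := hV.norm.sub hi3
  rw [← integral_sub hi1 hi2, ← integral_sub hV.norm hi3, ← integral_const_mul,
    ← integral_const_mul, ← integral_add (hV.norm.const_mul _) (hi4.const_mul _),
    ← integral_const_mul]
  refine norm_integral_le_of_norm_le (f := fun x => φ x * G x (V x) - _)
    (((hV.norm.const_mul _).add (hi4.const_mul _)).const_mul _)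
    (Eventually.of_forall fun x => ?_)
  have e : φ x * G x (V x) - ⟪(φ x * G x (Ψ x)) • Ψ x, V x⟫ =
      φ x * (G x (V x) - G x (Ψ x) * ⟪Ψ x, V x⟫) := by
    simp only [inner_smul_left, conj_trivial]; ring
  simp only [e, Real.norm_eq_abs, abs_mul]
  rw [mul_assoc C K]
  exact mul_le_mul (hφC x) (hG.abs_sub_linearization_le hK x hδ (hΨ1 x)) (abs_nonneg _)
    ((abs_nonneg _).trans (hφC x))

/-- **Reshetnyak's continuity theorem**: strict convergence of the vector measures `u_j m` to `U θ`
implies convergence of the integrals of positively homogeneous functions. -/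
theorem IsHomogLipschitz.tendsto_integral {K : ℝ} {G : X → F → ℝ} (hG : IsHomogLipschitz K G)
    (hK : 0 ≤ K) {m θ : Measure X} [IsFiniteMeasure θ] {u : ℕ → X → F} {U : X → F}
    (hu : ∀ j, Integrable (u j) m) (hU : Integrable U θ)
    (hweak : ∀ Ψ : X → F, Continuous Ψ → HasCompactSupport Ψ →
      Tendsto (fun j => ∫ x, ⟪Ψ x, u j x⟫ ∂m) atTop (𝓝 (∫ x, ⟪Ψ x, U x⟫ ∂θ)))
    (hmass : Tendsto (fun j => ∫ x, ‖u j x‖ ∂m) atTop (𝓝 (∫ x, ‖U x‖ ∂θ)))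
    {φ : X → ℝ} (hφ : Continuous φ) (hφs : HasCompactSupport φ) :
    Tendsto (fun j => ∫ x, φ x * G x (u j x) ∂m) atTop (𝓝 (∫ x, φ x * G x (U x) ∂θ)) := by
  obtain ⟨C, hC⟩ := hφs.exists_bound_of_continuous hφ
  simp only [Real.norm_eq_abs] at hC
  rw [Metric.tendsto_nhds]
  intro η hη
  set n := ∫ x, ‖U x‖ ∂θ
  have hn : 0 ≤ n := integral_nonneg fun _ => norm_nonneg _
  set B := |C| * K + 1
  have hB : 0 < B := by positivity
  have hCB : C * K ≤ B := by
    have := mul_le_mul_of_nonneg_right (le_abs_self C) hK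
    simp only [B]; linarith
  -- The linearization error is incurred once for `u j` and once for `U`. With this `δ`, and `Ψ`
  -- accurate to `η / (8 * B * κ)`, each error is at most `η / 4` in the limit.
  set δ := η / (8 * B * (n + 1))
  have hδ : 0 < δ := by positivity
  set κ := 1 + 1 / (2 * δ)
  have hκ : 0 < κ := by positivity
  obtain ⟨Ψ, hΨ, hΨs, hΨ1, hd⟩ := exists_compactlySupported_inner_approx hU
    (show 0 < η / (8 * B * κ) by positivity)
  have hUi : Integrable (fun x => ⟪Ψ x, U x⟫) θ := by
    refine hU.norm.mono' (hΨ.aestronglyMeasurable.inner hU.1)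
      (Eventually.of_forall fun x => (norm_inner_le_norm _ _).trans ?_)
    exact mul_le_of_le_one_left (norm_nonneg _) (hΨ1 x)
  rw [integral_sub hU.norm hUi] at hd
  have hd0 : 0 ≤ n - ∫ x, ⟪Ψ x, U x⟫ ∂θ := by
    rw [← integral_sub hU.norm hUi]
    refine integral_nonneg fun x => sub_nonneg.2 ((real_inner_le_norm _ _).trans ?_)
    exact mul_le_of_le_one_left (norm_nonneg _) (hΨ1 x)
  have hGΨ : Continuous fun x => G x (Ψ x) := hG.continuous.comp (continuous_id.prodMk hΨ)
  have hlin := hweak (fun x => (φ x * G x (Ψ x)) • Ψ x) ((hφ.mul hGΨ).smul hΨ) hΨs.smul_left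
  set l := ∫ x, ⟪(φ x * G x (Ψ x)) • Ψ x, U x⟫ ∂θ
  -- The error bound for `u j` converges to the one for `U`: this is the point where convergence of
  -- the masses is needed besides weak convergence.
  have hE := ((hmass.const_mul δ).add ((hmass.sub (hweak Ψ hΨ hΨs)).const_mul κ)).const_mul (C * K)
  have htot := (hE.add (hlin.sub_const l).abs).add_const
    (C * K * (δ * n + κ * (n - ∫ x, ⟪Ψ x, U x⟫ ∂θ)))
  have hlt : C * K * (δ * n + κ * (n - ∫ x, ⟪Ψ x, U x⟫ ∂θ)) + |l - l| +
      C * K * (δ * n + κ * (n - ∫ x, ⟪Ψ x, U x⟫ ∂θ)) < η := by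
    have h1 : δ * n ≤ η / (8 * B) := by
      rw [show δ * n = η / (8 * B) * (n / (n + 1)) by simp only [δ]; field_simp]
      refine mul_le_of_le_one_right (by positivity) ?_
      rw [div_le_one (by positivity)]; linarith
    have h2 : κ * (n - ∫ x, ⟪Ψ x, U x⟫ ∂θ) ≤ η / (8 * B) := by
      calc _ ≤ κ * (η / (8 * B * κ)) := by gcongr
        _ = _ := by field_simp
    have h3 : 0 ≤ δ * n + κ * (n - ∫ x, ⟪Ψ x, U x⟫ ∂θ) := by positivity
    have h4 : C * K * (δ * n + κ * (n - ∫ x, ⟪Ψ x, U x⟫ ∂θ)) ≤ η / 4 := by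
      calc _ ≤ B * (δ * n + κ * (n - ∫ x, ⟪Ψ x, U x⟫ ∂θ)) := by gcongr
        _ ≤ B * (η / (8 * B) + η / (8 * B)) := by gcongr
        _ = η / 4 := by field_simp; ring
    rw [sub_self, abs_zero]
    linarith
  filter_upwards [htot.eventually_lt_const hlt] with j hj
  refine lt_of_le_of_lt ?_ hj
  have e1 := hG.abs_integral_sub_linearization_le hK hδ hφ hC hΨ hΨ1 (hu j)
  have e2 := hG.abs_integral_sub_linearization_le hK hδ hφ hC hΨ hΨ1 hU
  rw [Real.dist_eq]
  rw [abs_le] at e1 e2 ⊢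
  have e3 := neg_abs_le (∫ x, ⟪(φ x * G x (Ψ x)) • Ψ x, u j x⟫ ∂m - l)
  have e4 := le_abs_self (∫ x, ⟪(φ x * G x (Ψ x)) • Ψ x, u j x⟫ ∂m - l)
  constructor <;> linarith [e1.1, e1.2, e2.1, e2.2]

end Reshetnyak

/-! ### Area-strict convergence -/

section AreaStrict

variable {X E : Type*} [MetricSpace X] [LocallyCompactSpace X] [SecondCountableTopology X]
  [MeasurableSpace X] [BorelSpace X] [NormedAddCommGroup E] [InnerProductSpace ℝ E]

omit [LocallyCompactSpace X] [SecondCountableTopology X] [MeasurableSpace X] [BorelSpace X] in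
/-- The homogeneous integrand on `E × ℝ` which belongs to `G(x, · - b(x))`. -/
theorem IsHomogLipschitz.lift {K B : ℝ} {G : X → E → ℝ} (hG : IsHomogLipschitz K G) (hK : 0 ≤ K)
    {b : X → E} (hb : Continuous b) (hbB : ∀ x, ‖b x‖ ≤ B) :
    IsHomogLipschitz (K * (1 + B)) fun x (p : WithLp 2 (E × ℝ)) => G x (p.fst - p.snd • b x) where
  continuous := by
    refine hG.continuous.comp (continuous_fst.prodMk (Continuous.sub ?_ (Continuous.smul ?_ ?_)))
    · exact continuous_fst.comp ((WithLp.prod_continuous_ofLp 2 E ℝ).comp continuous_snd)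
    · exact continuous_snd.comp ((WithLp.prod_continuous_ofLp 2 E ℝ).comp continuous_snd)
    · exact hb.comp continuous_fst
  smul x t z ht := by
    rw [← hG.smul x t _ ht, WithLp.smul_fst, WithLp.smul_snd, smul_sub, smul_assoc]
  lipschitz x z z' := by
    refine (hG.lipschitz x _ _).trans ?_
    rw [mul_assoc]
    refine mul_le_mul_of_nonneg_left ?_ hK
    have e : z.fst - z.snd • b x - (z'.fst - z'.snd • b x) =
        (z - z').fst - (z - z').snd • b x := by
      rw [WithLp.sub_fst, WithLp.sub_snd, sub_smul]; abel
    rw [e, add_mul, one_mul, mul_comm B]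
    refine (norm_sub_le _ _).trans (add_le_add (WithLp.norm_fst_le _ _) ?_)
    rw [norm_smul]
    exact mul_le_mul (WithLp.norm_snd_le _ _) (hbB x) (norm_nonneg _) (norm_nonneg _)

variable {m τ : Measure X} [IsFiniteMeasure m] [IsFiniteMeasure τ]

omit [MetricSpace X] [LocallyCompactSpace X] [SecondCountableTopology X] [BorelSpace X]
  [IsFiniteMeasure τ] in
theorem integrable_toLp_prod_one {a : X → E} (ha : Integrable a m) (c : ℝ) :
    Integrable (fun x => (WithLp.toLp 2 (a x, c) : WithLp 2 (E × ℝ))) m := by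
  have h1 : Integrable (fun x => (a x, c)) m := ha.prodMk (integrable_const c)
  exact (WithLp.prodContinuousLinearEquiv 2 ℝ E ℝ).symm.toContinuousLinearMap.integrable_comp h1

omit [MetricSpace X] [LocallyCompactSpace X] [SecondCountableTopology X] [BorelSpace X]
  [MeasurableSpace X] [InnerProductSpace ℝ E] in
theorem norm_toLp_prod (z : E) (c : ℝ) :
    ‖(WithLp.toLp 2 (z, c) : WithLp 2 (E × ℝ))‖ = √(c ^ 2 + ‖z‖ ^ 2) := by
  rw [WithLp.prod_norm_eq_of_L2]
  simp [add_comm]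

variable {u : ℕ → X → E} {a s : X → E}

/-- The area of `z` is the norm of `(z, 1)`, so the hypotheses say that `(u j, 1) m` converges
strictly to `(a m + s τ, m)`. Reshetnyak's theorem applies to the lifted integrand `G x (z - c • b
x)`, which is again homogeneous in `(z, c)`. -/
theorem tendsto_integral_of_areaStrict (hmτ : m ⟂ₘ τ) (hu : ∀ j, Integrable (u j) m)
    (ha : Integrable a m) (hs : Integrable s τ) (hs1 : ∀ᵐ x ∂τ, ‖s x‖ = 1)
    (hweak : ∀ Ψ : X → E, Continuous Ψ → HasCompactSupport Ψ →
      Tendsto (fun j => ∫ x, ⟪Ψ x, u j x⟫ ∂m) atTop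
        (𝓝 (∫ x, ⟪Ψ x, a x⟫ ∂m + ∫ x, ⟪Ψ x, s x⟫ ∂τ)))
    (harea : Tendsto (fun j => ∫ x, √(1 + ‖u j x‖ ^ 2) ∂m) atTop
      (𝓝 (∫ x, √(1 + ‖a x‖ ^ 2) ∂m + τ.real Set.univ)))
    {K B : ℝ} {G : X → E → ℝ} (hG : IsHomogLipschitz K G) (hK : 0 ≤ K)
    {b : X → E} (hb : Continuous b) (hbB : ∀ x, ‖b x‖ ≤ B)
    {φ : X → ℝ} (hφ : Continuous φ) (hφs : HasCompactSupport φ) :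
    Tendsto (fun j => ∫ x, φ x * G x (u j x - b x) ∂m) atTop
      (𝓝 (∫ x, φ x * G x (a x - b x) ∂m + ∫ x, φ x * G x (s x) ∂τ)) := by
  classical
  have hB : 0 ≤ K * (1 + B) ∨ IsEmpty X := by
    rcases isEmpty_or_nonempty X with h | ⟨⟨x⟩⟩
    · exact Or.inr h
    · have := (norm_nonneg _).trans (hbB x)
      exact Or.inl (by positivity)
  rcases hB with hB | hX
  swap
  · simp [Measure.eq_zero_of_isEmpty]
  set S := hmτ.nullSet
  -- The density of the lifted limit with respect to `m + τ`. The last coordinate is `0` on the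
  -- `m`-null set `S` carrying `τ`, so `b` has no effect there.
  let U : X → WithLp 2 (E × ℝ) :=
    fun x => if x ∈ S then WithLp.toLp 2 (s x, 0) else WithLp.toLp 2 (a x, 1)
  have hUm : ∀ᵐ x ∂m, U x = WithLp.toLp 2 (a x, 1) := by
    have : ∀ᵐ x ∂m, x ∉ S := measure_eq_zero_iff_ae_notMem.1 hmτ.measure_nullSet
    filter_upwards [this] with x hx
    simp [U, hx]
  have hUτ : ∀ᵐ x ∂τ, U x = WithLp.toLp 2 (s x, 0) := by
    have : ∀ᵐ x ∂τ, x ∉ Sᶜ := measure_eq_zero_iff_ae_notMem.1 hmτ.measure_compl_nullSet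
    filter_upwards [this] with x hx
    have : x ∈ S := by simpa using hx
    simp [U, this]
  have hI1 := integrable_toLp_prod_one ha 1
  have hI2 := integrable_toLp_prod_one hs 0
  have hUI : Integrable U (m + τ) :=
    (hI1.congr (hUm.mono fun x hx => hx.symm)).add_measure
      (hI2.congr (hUτ.mono fun x hx => hx.symm))
  have key : ∀ H : X → WithLp 2 (E × ℝ) → ℝ,
      Integrable (fun x => H x (WithLp.toLp 2 (a x, 1))) m →
      Integrable (fun x => H x (WithLp.toLp 2 (s x, 0))) τ →
      ∫ x, H x (U x) ∂(m + τ) = ∫ x, H x (WithLp.toLp 2 (a x, 1)) ∂m +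
        ∫ x, H x (WithLp.toLp 2 (s x, 0)) ∂τ := by
    intro H h1 h2
    have e1 : (fun x => H x (U x)) =ᵐ[m] fun x => H x (WithLp.toLp 2 (a x, 1)) :=
      hUm.mono fun x hx => by simp only [hx]
    have e2 : (fun x => H x (U x)) =ᵐ[τ] fun x => H x (WithLp.toLp 2 (s x, 0)) :=
      hUτ.mono fun x hx => by simp only [hx]
    rw [integral_add_measure (h1.congr e1.symm) (h2.congr e2.symm), integral_congr_ae e1,
      integral_congr_ae e2]
  have hinner : ∀ {ν : Measure X} [IsFiniteMeasure ν] {F : Type _} [NormedAddCommGroup F]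
      [InnerProductSpace ℝ F] {V Ψ : X → F}, Integrable V ν → Continuous Ψ →
      HasCompactSupport Ψ → Integrable (fun x => ⟪Ψ x, V x⟫) ν := by
    intro ν _ F _ _ V Ψ hV hΨ hΨs
    obtain ⟨C, hC⟩ := hΨs.exists_bound_of_continuous hΨ
    refine (hV.norm.const_mul C).mono' (hΨ.aestronglyMeasurable.inner hV.1)
      (Eventually.of_forall fun x => (norm_inner_le_norm _ _).trans ?_)
    exact mul_le_mul_of_nonneg_right (hC x) (norm_nonneg _)
  obtain ⟨C, hC⟩ := hφs.exists_bound_of_continuous hφ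
  have hG' := hG.lift hK hb hbB
  have hGi : ∀ {ν : Measure X} {V : X → WithLp 2 (E × ℝ)}, Integrable V ν →
      Integrable (fun x => φ x * G x ((V x).fst - (V x).snd • b x)) ν := fun hV =>
    (hG'.integrable hV).bdd_mul hφ.aestronglyMeasurable (Eventually.of_forall hC)
  have main := hG'.tendsto_integral hB (m := m) (θ := m + τ)
    (u := fun j x => WithLp.toLp 2 (u j x, 1)) (U := U)
    (fun j => integrable_toLp_prod_one (hu j) 1) hUI ?_ ?_ hφ hφs
  · rw [key (fun x p => φ x * G x (p.fst - p.snd • b x)) (hGi hI1) (hGi hI2)] at main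
    simpa using main
  · intro Ψ hΨ hΨs
    have hc1 : Continuous fun x => (Ψ x).fst :=
      continuous_fst.comp ((WithLp.prod_continuous_ofLp 2 E ℝ).comp hΨ)
    have hc2 : Continuous fun x => (Ψ x).snd :=
      continuous_snd.comp ((WithLp.prod_continuous_ofLp 2 E ℝ).comp hΨ)
    have hs1 : HasCompactSupport fun x => (Ψ x).fst :=
      hΨs.comp_left (g := fun p : WithLp 2 (E × ℝ) => p.fst) rfl
    have hs2 : HasCompactSupport fun x => (Ψ x).snd :=
      hΨs.comp_left (g := fun p : WithLp 2 (E × ℝ) => p.snd) rfl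
    have hi0 : Integrable (fun x => (Ψ x).snd) m := hc2.integrable_of_hasCompactSupport hs2
    have e : ∀ (x : X) (z : E), ⟪Ψ x, WithLp.toLp 2 (z, (1 : ℝ))⟫ = ⟪(Ψ x).fst, z⟫ + (Ψ x).snd := by
      intro x z
      simp [WithLp.prod_inner_apply]
    have e0 : ∀ (x : X) (z : E), ⟪Ψ x, WithLp.toLp 2 (z, (0 : ℝ))⟫ = ⟪(Ψ x).fst, z⟫ := by
      intro x z
      simp [WithLp.prod_inner_apply]
    rw [key (fun x p => ⟪Ψ x, p⟫) (hinner hI1 hΨ hΨs) (hinner hI2 hΨ hΨs)]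
    simp only [e, e0]
    rw [integral_add (hinner ha hc1 hs1) hi0]
    simp only [integral_add (hinner (hu _) hc1 hs1) hi0]
    have := (hweak _ hc1 hs1).add_const (∫ x, (Ψ x).snd ∂m)
    convert this using 2
    ring
  · rw [key (fun _ p => ‖p‖) hI1.norm hI2.norm]
    simp only [norm_toLp_prod]
    have e : ∫ x, √((0 : ℝ) ^ 2 + ‖s x‖ ^ 2) ∂τ = τ.real Set.univ := by
      rw [integral_congr_ae (g := fun _ => (1 : ℝ)) (hs1.mono fun x hx => by simp [hx])]
      simp
    rw [e]
    simpa using harea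

/-- Only `u j - b` is estimated by `G`, while `b` is paired with `v` exactly. As `b` approaches `a`
in `L¹`, the loss on the absolutely continuous part vanishes. -/
theorem le_of_areaStrict (hmτ : m ⟂ₘ τ) (hu : ∀ j, Integrable (u j) m)
    (ha : Integrable a m) (hs : Integrable s τ) (hs1 : ∀ᵐ x ∂τ, ‖s x‖ = 1)
    (hweak : ∀ Ψ : X → E, Continuous Ψ → HasCompactSupport Ψ →
      Tendsto (fun j => ∫ x, ⟪Ψ x, u j x⟫ ∂m) atTop
        (𝓝 (∫ x, ⟪Ψ x, a x⟫ ∂m + ∫ x, ⟪Ψ x, s x⟫ ∂τ)))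
    (harea : Tendsto (fun j => ∫ x, √(1 + ‖u j x‖ ^ 2) ∂m) atTop
      (𝓝 (∫ x, √(1 + ‖a x‖ ^ 2) ∂m + τ.real Set.univ)))
    {K : ℝ} {G : X → E → ℝ} (hG : IsHomogLipschitz K G) (hK : 0 ≤ K)
    {v : X → E} (hv : AEStronglyMeasurable v m) {D : ℝ} (hvD : ∀ᵐ x ∂m, ‖v x‖ ≤ D)
    (hvG : ∀ᵐ x ∂m, ∀ z, ⟪z, v x⟫ ≤ G x z)
    {φ : X → ℝ} (hφ : Continuous φ) (hφs : HasCompactSupport φ) (hφ0 : ∀ x, 0 ≤ φ x)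
    {Λ : ℝ} (hΛ : Tendsto (fun j => ∫ x, φ x * ⟪u j x, v x⟫ ∂m) atTop (𝓝 Λ)) :
    Λ ≤ ∫ x, φ x * ⟪a x, v x⟫ ∂m + ∫ x, φ x * G x (s x) ∂τ := by
  obtain ⟨C, hC⟩ := hφs.exists_bound_of_continuous hφ
  have hpair : ∀ {V : X → E}, Integrable V m → Integrable (fun x => φ x * ⟪V x, v x⟫) m := by
    intro V hV
    refine Integrable.bdd_mul ?_ hφ.aestronglyMeasurable (Eventually.of_forall hC)
    refine (hV.norm.const_mul D).mono' (hV.1.inner hv) (hvD.mono fun x hx => ?_)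
    refine (norm_inner_le_norm _ _).trans ?_
    rw [mul_comm]
    exact mul_le_mul_of_nonneg_right hx (norm_nonneg _)
  have hGi : ∀ {V : X → E}, Integrable V m → Integrable (fun x => φ x * G x (V x)) m := fun hV =>
    (hG.integrable hV).bdd_mul hφ.aestronglyMeasurable (Eventually.of_forall hC)
  refine le_of_forall_pos_le_add fun ε hε => ?_
  -- Bounds the cost, per unit of `‖a - b‖`, of replacing `⟪a - b, v⟫` by `G x (a - b)` under the
  -- weight `φ`; the `+ 1` keeps it positive.
  set T := |C| * (K + |D|) + 1
  have hT : 0 < T := by positivity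
  obtain ⟨b, hbs, hab, hb, hbi⟩ := ha.exists_hasCompactSupport_integral_sub_le (div_pos hε hT)
  obtain ⟨B, hB⟩ := hbs.exists_bound_of_continuous hb
  have hlim := (tendsto_integral_of_areaStrict hmτ hu ha hs hs1 hweak harea hG hK hb hB hφ
    hφs).add_const (∫ x, φ x * ⟪b x, v x⟫ ∂m)
  have h1 : Λ ≤ ∫ x, φ x * G x (a x - b x) ∂m + ∫ x, φ x * G x (s x) ∂τ +
      ∫ x, φ x * ⟪b x, v x⟫ ∂m := by
    refine le_of_tendsto_of_tendsto' hΛ hlim fun j => ?_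
    have hi := hGi ((hu j).sub hbi)
    simp only [Pi.sub_apply] at hi
    rw [← integral_add hi (hpair hbi)]
    refine integral_mono_ae (hpair (hu j)) (hi.add (hpair hbi)) (hvG.mono fun x hx => ?_)
    have := mul_le_mul_of_nonneg_left (hx (u j x - b x)) (hφ0 x)
    rw [inner_sub_left] at this
    linarith
  have hi := hGi (ha.sub hbi)
  simp only [Pi.sub_apply] at hi
  have h2 : ∫ x, φ x * G x (a x - b x) ∂m + ∫ x, φ x * ⟪b x, v x⟫ ∂m - ∫ x, φ x * ⟪a x, v x⟫ ∂m ≤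
      T * ∫ x, ‖a x - b x‖ ∂m := by
    have hi' : Integrable (fun x => φ x * G x (a x - b x) + φ x * ⟪b x, v x⟫) m :=
      hi.add (hpair hbi)
    rw [← integral_add hi (hpair hbi), ← integral_sub hi' (hpair ha), ← integral_const_mul]
    refine integral_mono_ae (hi'.sub (hpair ha)) ((ha.sub hbi).norm.const_mul T)
      (hvD.mono fun x hx => ?_)
    have e1 := hG.abs_apply_le x (a x - b x)
    have e2 : |⟪a x - b x, v x⟫| ≤ |D| * ‖a x - b x‖ := by
      refine (abs_real_inner_le_norm _ _).trans ?_
      rw [mul_comm]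
      exact mul_le_mul_of_nonneg_right (hx.trans (le_abs_self D)) (norm_nonneg _)
    rw [inner_sub_left] at e2
    have e3 : G x (a x - b x) - (⟪a x, v x⟫ - ⟪b x, v x⟫) ≤ (K + |D|) * ‖a x - b x‖ := by
      linarith [(abs_le.1 e1).2, (abs_le.1 e2).1]
    have e4 : φ x ≤ |C| := ((le_abs_self _).trans (hC x)).trans (le_abs_self C)
    calc _ = φ x * (G x (a x - b x) - (⟪a x, v x⟫ - ⟪b x, v x⟫)) := by ring
      _ ≤ φ x * ((K + |D|) * ‖a x - b x‖) := mul_le_mul_of_nonneg_left e3 (hφ0 x)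
      _ ≤ |C| * ((K + |D|) * ‖a x - b x‖) := mul_le_mul_of_nonneg_right e4 (by positivity)
      _ ≤ T * ‖a x - b x‖ := by simp only [T]; nlinarith [norm_nonneg (a x - b x)]
  have h3 : T * ∫ x, ‖a x - b x‖ ∂m ≤ ε := by
    calc _ ≤ T * (ε / T) := by gcongr
      _ = ε := by field_simp
  linarith

end AreaStrict

/-! ### Vector measures -/

section VectorMeasures

variable {X F : Type*} [MeasurableSpace X] [NormedAddCommGroup F] [NormedSpace ℝ F]

instance instIsFiniteMeasureVariationSigned (ν : SignedMeasure X) :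
    IsFiniteMeasure ν.variation := by
  rw [← SignedMeasure.totalVariation_eq_variation]
  infer_instance

/-- Both sides are continuous in `φ` for the `L¹` norm of the variation `‖h‖ θ`, so indicator
functions suffice. -/
theorem integral_withDensityᵥ [CompleteSpace F] {θ : Measure X} {h : X → F} (hh : Integrable h θ)
    {φ : X → ℝ} (hφ : Integrable φ (θ.withDensityᵥ h).variation) :
    ∫ᵛ x, φ x ∂•(θ.withDensityᵥ h) = ∫ x, φ x • h x ∂θ := by
  have hvar := Measure.variation_withDensityᵥ hh
  have hlt : ∀ᵐ x ∂θ, ‖h x‖ₑ < ⊤ := by simp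
  have hint : ∀ k : X → ℝ, ∫ x, k x ∂(θ.withDensityᵥ h).variation = ∫ x, ‖h x‖ * k x ∂θ := by
    intro k
    rw [hvar, integral_withDensity_eq_integral_toReal_smul₀ hh.1.enorm hlt]
    simp only [toReal_enorm, smul_eq_mul]
  have hnorm : ∀ g : X → ℝ, Integrable g (θ.withDensityᵥ h).variation →
      Integrable (fun x => g x • h x) θ := by
    intro g hg
    rw [hvar, integrable_withDensity_iff_integrable_smul₀' hh.1.enorm hlt] at hg
    have : Integrable (fun x => ‖h x‖ • g x) θ := by simpa using hg
    -- A priori `g` is measurable only modulo null sets of `‖h‖ θ`, so the product is regrouped as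
    -- `(‖h‖ g) • (h / ‖h‖)`.
    have h0 : AEStronglyMeasurable (fun x => g x • h x) θ := by
      have h1 : AEStronglyMeasurable (fun x => (‖h x‖ * g x) • (‖h x‖⁻¹ • h x)) θ :=
        this.1.smul ((hh.1.norm.aemeasurable.inv.aestronglyMeasurable).smul hh.1)
      refine h1.congr (Eventually.of_forall fun x => ?_)
      by_cases hx : h x = 0
      · simp [hx]
      · have : ‖h x‖ ≠ 0 := norm_ne_zero_iff.2 hx
        simp only [smul_smul]
        congr 1
        field_simp
    refine this.mono h0 (Eventually.of_forall fun x => ?_)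
    simp [norm_smul, mul_comm]
  refine Integrable.induction (P := fun φ : X → ℝ =>
    ∫ᵛ x, φ x ∂•(θ.withDensityᵥ h) = ∫ x, φ x • h x ∂θ) ?_ ?_ ?_ ?_ hφ
  · intro c s hs _
    have : IsFiniteMeasure (θ.withDensityᵥ h).variation := by
      rw [hvar]; exact isFiniteMeasure_withDensity hh.2.ne
    have e : ∀ x, s.indicator (fun _ => c) x • h x = s.indicator (fun x => c • h x) x := by
      intro x
      by_cases hx : x ∈ s <;> simp [hx]
    simp only [e]
    rw [VectorMeasure.integral_indicator hs, VectorMeasure.integral_const,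
      integral_indicator hs, integral_smul, VectorMeasure.restrict_apply _ hs MeasurableSet.univ,
      Set.univ_inter, withDensityᵥ_apply hh hs]
    rfl
  · intro f g _ hf hg h1 h2
    rw [VectorMeasure.integral_add hf hg, h1, h2, ← integral_add (hnorm f hf) (hnorm g hg)]
    simp [add_smul]
  · have hd : ∀ f g : X →₁[(θ.withDensityᵥ h).variation] ℝ,
        dist (∫ x, f x • h x ∂θ) (∫ x, g x • h x ∂θ) ≤ dist f g := by
      intro f g
      rw [dist_eq_norm, ← integral_sub (hnorm f (L1.integrable_coeFn f))
        (hnorm g (L1.integrable_coeFn g)), dist_eq_norm, L1.norm_eq_integral_norm]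
      refine (norm_integral_le_integral_norm _).trans (le_of_eq ?_)
      rw [integral_congr_ae ((Lp.coeFn_sub f g).mono fun x hx => congrArg norm hx)]
      rw [hint]
      refine integral_congr_ae (Eventually.of_forall fun x => ?_)
      simp only [← sub_smul, norm_smul, Pi.sub_apply]
      ring
    exact isClosed_eq VectorMeasure.continuous_integral
      (LipschitzWith.of_dist_le' (K := 1) fun f g => by simpa using hd f g).continuous
  · intro f g hfg _ h1
    rw [← VectorMeasure.integral_congr_ae hfg, h1]
    refine integral_congr_ae ?_
    rw [hvar] at hfg
    have := (ae_withDensity_iff' hh.1.enorm).1 hfg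
    filter_upwards [this] with x hx
    by_cases h0 : h x = 0
    · simp [h0]
    · rw [hx (by simpa using h0)]

/-- A signed measure which is nonpositive on nonnegative test functions is nonpositive. -/
theorem signedMeasure_apply_le_zero [MetricSpace X] [LocallyCompactSpace X]
    [SecondCountableTopology X] [BorelSpace X] {ν : SignedMeasure X}
    (h : ∀ φ : X → ℝ, Continuous φ → HasCompactSupport φ → (∀ x, 0 ≤ φ x) →
      ∫ᵛ x, φ x ∂•ν ≤ 0) {B : Set X} (hB : MeasurableSet B) : ν B ≤ 0 := by
  refine le_of_forall_pos_le_add fun ε hε => ?_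
  have hi : Integrable (B.indicator fun _ => (1 : ℝ)) ν.variation :=
    (integrable_const 1).indicator hB
  have hε' : 0 < ε / (‖ContinuousLinearMap.lsmul ℝ ℝ (E := ℝ)‖ + 1) := by positivity
  obtain ⟨g, hgs, hg, hgc, hgi⟩ := hi.exists_hasCompactSupport_integral_sub_le hε'
  -- Passing to `|g|` makes the approximation an admissible test function without increasing its
  -- distance to the nonnegative indicator.
  have h1 := h (fun x => |g x|) hgc.abs hgs.norm (fun x => abs_nonneg _)
  have h2 : ∫ᵛ x, B.indicator (fun _ => (1 : ℝ)) x ∂•ν = ν B := by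
    rw [VectorMeasure.integral_indicator hB, VectorMeasure.integral_const,
      VectorMeasure.restrict_apply _ hB MeasurableSet.univ, Set.univ_inter]
    simp
  have h3 : ν B - ∫ᵛ x, |g x| ∂•ν ≤ ε := by
    rw [← h2, ← VectorMeasure.integral_fun_sub hi hgi.abs]
    refine (Real.le_norm_self _).trans
      ((VectorMeasure.norm_integral_le_integral_norm (μ := ν)).trans ?_)
    calc _ ≤ (‖ContinuousLinearMap.lsmul ℝ ℝ (E := ℝ)‖ + 1) *
          ∫ x, ‖B.indicator (fun _ => (1 : ℝ)) x - g x‖ ∂ν.variation := by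
          refine mul_le_mul (by linarith) ?_ (integral_nonneg fun _ => norm_nonneg _)
            (by positivity)
          refine integral_mono (hi.sub hgi.abs).norm (hi.sub hgi).norm fun x => ?_
          have e : B.indicator (fun _ => (1 : ℝ)) x = |B.indicator (fun _ => (1 : ℝ)) x| := by
            by_cases hx : x ∈ B <;> simp [hx]
          simp only [Real.norm_eq_abs]
          conv_lhs => rw [e]
          exact abs_abs_sub_abs_le _ _
      _ ≤ _ := by
          refine (mul_le_mul_of_nonneg_left hg (by positivity)).trans (le_of_eq ?_)
          field_simp
  linarith

/-- The two-sided bound makes `t = lam - p m` absolutely continuous with respect to `τ`, hence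
singular to `m`. So `p` is the `m`-density of `lam`, and `lam` and `t` have the same `τ`-density.
The one-sided bound then reads `t B ≤ ∫ x in B, q x ∂τ`. -/
theorem signedMeasure_rnDeriv_of_bounds {m τ : Measure X} [IsFiniteMeasure m] [IsFiniteMeasure τ]
    (hmτ : m ⟂ₘ τ) {lam : SignedMeasure X} {p q : X → ℝ} (hp : Integrable p m)
    (hq : Integrable q τ) {C : ℝ}
    (hup : ∀ B, MeasurableSet B → lam B ≤ ∫ x in B, p x ∂m + ∫ x in B, q x ∂τ)
    (habs : ∀ B, MeasurableSet B → |lam B - ∫ x in B, p x ∂m| ≤ C * τ.real B) :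
    lam.rnDeriv m =ᵐ[m] p ∧ lam.rnDeriv τ ≤ᵐ[τ] q := by
  set S := hmτ.nullSet
  have hS : MeasurableSet S := hmτ.measurableSet_nullSet
  set t : SignedMeasure X := lam - m.withDensityᵥ p
  have ht : ∀ B, MeasurableSet B → t B = lam B - ∫ x in B, p x ∂m := by
    intro B hB
    simp only [t, _root_.sub_apply, withDensityᵥ_apply hp hB]
  have htτ : ∀ B, MeasurableSet B → τ B = 0 → t B = 0 := by
    intro B hB h0
    have := habs B hB
    rw [measureReal_def, h0, ENNReal.toReal_zero, mul_zero] at this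
    rw [ht B hB]
    exact abs_nonpos_iff.1 this
  have htm : t ⟂ᵥ m.toENNRealVectorMeasure := by
    refine VectorMeasure.MutuallySingular.mk Sᶜ hS.compl (fun B hBS hB => ?_) fun B hBS hB => ?_
    · exact htτ B hB (measure_mono_null hBS hmτ.measure_compl_nullSet)
    · rw [compl_compl] at hBS
      rw [Measure.toENNRealVectorMeasure_apply_measurable hB]
      exact measure_mono_null hBS hmτ.measure_nullSet
  have hlam : lam = t + m.withDensityᵥ p := by simp [t]
  have hac : t ≪ᵥ τ.toENNRealVectorMeasure := by
    refine VectorMeasure.AbsolutelyContinuous.mk fun B hB h0 => htτ B hB ?_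
    rwa [Measure.toENNRealVectorMeasure_apply_measurable hB] at h0
  have hr := SignedMeasure.withDensityᵥ_rnDeriv_eq t τ hac
  set r := t.rnDeriv τ
  have hri : Integrable r τ := SignedMeasure.integrable_rnDeriv _ _
  have hpτ : m.withDensityᵥ p ⟂ᵥ τ.toENNRealVectorMeasure := by
    refine VectorMeasure.MutuallySingular.mk S hS (fun B hBS hB => ?_) fun B hBS hB => ?_
    · rw [withDensityᵥ_apply hp hB, Measure.restrict_eq_zero.2
        (measure_mono_null hBS hmτ.measure_nullSet), integral_zero_measure]
    · rw [Measure.toENNRealVectorMeasure_apply_measurable hB]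
      exact measure_mono_null hBS hmτ.measure_compl_nullSet
  have hlr : r =ᵐ[τ] lam.rnDeriv τ := by
    refine SignedMeasure.eq_rnDeriv _ r hri hpτ ?_
    rw [hr, hlam]
    abel
  refine ⟨(SignedMeasure.eq_rnDeriv t p hp htm hlam).symm, hlr.symm.le.trans ?_⟩
  refine ae_le_of_forall_setIntegral_le hri hq fun B hB _ => ?_
  rw [← withDensityᵥ_apply hri hB, hr, ht B hB]
  linarith [hup B hB]

end VectorMeasures

/-! ### Decomposition of `ℝᴺ`-valued measures -/

section Decomposition

variable {d N : ℕ} {Ω : TopologicalSpace.Opens (Eu d)}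

@[simp]
theorem component_apply (μ : VMeas Ω N) (i : Fin N) (B : Set Ω) : component μ i B = μ B i := rfl

theorem norm_le_sum_norm_apply (z : Eu N) : ‖z‖ ≤ ∑ i, ‖z i‖ := by
  conv_lhs => rw [← (EuclideanSpace.basisFun (Fin N) ℝ).sum_repr z]
  refine (norm_sum_le _ _).trans (Finset.sum_le_sum fun i _ => ?_)
  simp [norm_smul]

/-- Carries finiteness and singularity of the variation over from the scalar components. -/
theorem variation_le_sum_component (μ : VMeas Ω N) :
    μ.variation ≤ ∑ i, (component μ i).variation := by
  refine VectorMeasure.variation_le_of_forall_enorm_le fun B hB => ?_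
  rw [Measure.finsetSum_apply]
  calc ‖μ B‖ₑ = ENNReal.ofReal ‖μ B‖ := (ofReal_norm _).symm
    _ ≤ ENNReal.ofReal (∑ i, ‖μ B i‖) := ENNReal.ofReal_le_ofReal (norm_le_sum_norm_apply _)
    _ = ∑ i, ‖component μ i B‖ₑ := by
        rw [ENNReal.ofReal_sum_of_nonneg fun _ _ => norm_nonneg _]
        simp only [ofReal_norm, component_apply]
    _ ≤ _ := Finset.sum_le_sum fun i _ => VectorMeasure.enorm_measure_le_variation _ _

instance instIsFiniteMeasureVariation (μ : VMeas Ω N) : IsFiniteMeasure μ.variation :=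
  isFiniteMeasure_of_le _ (variation_le_sum_component μ)

theorem integrable_density (μ : VMeas Ω N) (ν : Measure Ω) : Integrable (density μ ν) ν :=
  Integrable.of_eval_piLp fun i => SignedMeasure.integrable_rnDeriv (component μ i) ν

theorem component_withDensityᵥ {θ : Measure Ω} {h : Ω → Eu N} (hh : Integrable h θ) (i : Fin N) :
    component (θ.withDensityᵥ h) i = θ.withDensityᵥ fun x => h x i := by
  ext B hB
  rw [component_apply, withDensityᵥ_apply hh hB, withDensityᵥ_apply (hh.eval_piLp i) hB,
    eval_integral_piLp fun i => (hh.eval_piLp i).integrableOn]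

theorem vmeas_ext {μ ν : VMeas Ω N} (h : ∀ i, component μ i = component ν i) : μ = ν := by
  ext B hB i
  rw [← component_apply, h, component_apply]

theorem withDensityᵥ_density {μ : VMeas Ω N} {θ : Measure Ω} [SigmaFinite θ]
    (h : ∀ B, MeasurableSet B → θ B = 0 → μ B = 0) : θ.withDensityᵥ (density μ θ) = μ := by
  refine vmeas_ext fun i => ?_
  rw [component_withDensityᵥ (integrable_density μ θ)]
  refine SignedMeasure.withDensityᵥ_rnDeriv_eq (component μ i) θ ?_
  refine VectorMeasure.AbsolutelyContinuous.mk fun B hB h0 => ?_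
  rw [Measure.toENNRealVectorMeasure_apply_measurable hB] at h0
  simp [h B hB h0]

theorem withDensityᵥ_density_variation (μ : VMeas Ω N) :
    μ.variation.withDensityᵥ (density μ μ.variation) = μ :=
  withDensityᵥ_density fun B _ h0 => by
    have := VectorMeasure.enorm_measure_le_variation μ B
    rwa [h0, nonpos_iff_eq_zero, enorm_eq_zero] at this

/-- The polar decomposition of a vector measure. -/
theorem norm_density_variation (μ : VMeas Ω N) :
    ∀ᵐ x ∂μ.variation, ‖density μ μ.variation x‖ = 1 := by
  have h1 := Measure.variation_withDensityᵥ (integrable_density μ μ.variation)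
  rw [withDensityᵥ_density_variation] at h1
  have h2 : μ.variation.withDensity (fun x => ‖density μ μ.variation x‖ₑ) =
      μ.variation.withDensity 1 := by rw [withDensity_one, ← h1]
  have h3 := (withDensity_eq_iff_of_sigmaFinite
    (integrable_density μ μ.variation).1.enorm aemeasurable_const).1 h2
  filter_upwards [h3] with x hx
  have := congrArg ENNReal.toReal hx
  simpa using this

variable [IsFiniteMeasure (volume : Measure Ω)]

/-- `singularPart` is defined by subtraction; this identifies it with the scalar Lebesgue
decompositions, from which its singularity is inherited. -/
theorem component_singularPart (μ : VMeas Ω N) (i : Fin N) :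
    component (singularPart μ) i = (component μ i).singularPart volume := by
  have h := (component μ i).singularPart_add_withDensity_rnDeriv_eq (μ := volume)
  have h2 := component_withDensityᵥ (integrable_density μ volume) i
  have h3 : component (singularPart μ) i =
      component μ i - component ((volume : Measure Ω).withDensityᵥ (density μ volume)) i := by
    ext B hB
    simp [singularPart]
  rw [h3, h2, sub_eq_iff_eq_add]
  exact h.symm

theorem mutuallySingular_variation_singularPart (μ : VMeas Ω N) :
    (volume : Measure Ω) ⟂ₘ (singularPart μ).variation := by
  refine Measure.MutuallySingular.symm ?_
  refine Measure.MutuallySingular.mono_ac (μ₁ := Measure.sum fun i =>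
    (component (singularPart μ) i).variation) ?_ ?_ Measure.AbsolutelyContinuous.rfl
  · rw [Measure.MutuallySingular.sum_left]
    intro i
    rw [component_singularPart, ← SignedMeasure.totalVariation_eq_variation]
    have := (component μ i).mutuallySingular_singularPart volume
    rwa [SignedMeasure.mutuallySingular_ennreal_iff,
      VectorMeasure.ennrealToMeasure_toENNRealVectorMeasure] at this
  · rw [Measure.sum_fintype]
    exact (variation_le_sum_component _).absolutelyContinuous

/-- `μ` and `singularPart μ` differ by a measure with a Lebesgue density, which does not charge the
Lebesgue-null set carrying the singular part. -/
theorem density_singularPart_ae_eq (μ : VMeas Ω N) :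
    density μ (singularPart μ).variation =ᵐ[(singularPart μ).variation]
      density (singularPart μ) (singularPart μ).variation := by
  set τ := (singularPart μ).variation
  have hsing := mutuallySingular_variation_singularPart μ
  have hi : ∀ i, ∀ᵐ x ∂τ, (component μ i).rnDeriv τ x =
      (component (singularPart μ) i).rnDeriv τ x := by
    intro i
    have hint := integrable_density μ (volume : Measure Ω)
    have e1 := component_withDensityᵥ (integrable_density (singularPart μ) τ) i
    rw [withDensityᵥ_density_variation] at e1
    have e2 := component_withDensityᵥ hint i
    refine (SignedMeasure.eq_rnDeriv (component ((volume : Measure Ω).withDensityᵥ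
      (density μ volume)) i) _ (SignedMeasure.integrable_rnDeriv _ _) ?_ ?_).symm
    · rw [e2]
      refine VectorMeasure.MutuallySingular.mk _ hsing.measurableSet_nullSet
        (fun B hBS hB => ?_) fun B hBS hB => ?_
      · rw [withDensityᵥ_apply (hint.eval_piLp i) hB, Measure.restrict_eq_zero.2
          (measure_mono_null hBS hsing.measure_nullSet), integral_zero_measure]
      · rw [Measure.toENNRealVectorMeasure_apply_measurable hB]
        exact measure_mono_null hBS hsing.measure_compl_nullSet
    · change component μ i = _ + τ.withDensityᵥ fun x => density (singularPart μ) τ x i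
      rw [← e1]
      ext B hB
      simp [singularPart]
  filter_upwards [ae_all_iff.2 hi] with x hx
  ext i
  exact hx i

/-- On a Lebesgue-null set carrying the singular part, `μ` and `singularPart μ` coincide. Hence
`μ.variation` is `τ` plus a measure singular to `τ`, and that extra term does not change derivatives
`τ`-almost everywhere. -/
theorem rnDeriv_variation_ae_eq (lam : SignedMeasure Ω) (μ : VMeas Ω N) :
    lam.rnDeriv μ.variation =ᵐ[(singularPart μ).variation]
      lam.rnDeriv (singularPart μ).variation := by
  have hsing := mutuallySingular_variation_singularPart μ
  set τ := (singularPart μ).variation with hτ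
  set S := hsing.nullSet
  have hS : MeasurableSet S := hsing.measurableSet_nullSet
  have hint := integrable_density μ (volume : Measure Ω)
  have e1 : μ.restrict S = (singularPart μ).restrict S := by
    ext1 B hB
    rw [VectorMeasure.restrict_apply _ hS hB, VectorMeasure.restrict_apply _ hS hB]
    simp only [singularPart, _root_.sub_apply]
    rw [withDensityᵥ_apply hint (hB.inter hS), Measure.restrict_eq_zero.2
      (measure_mono_null Set.inter_subset_right hsing.measure_nullSet), integral_zero_measure,
      sub_zero]
  have e2 : μ.variation.restrict S = τ := by
    rw [← VectorMeasure.variation_restrict hS, e1, VectorMeasure.variation_restrict hS, ← hτ]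
    refine Measure.restrict_eq_self_of_ae_mem ?_
    filter_upwards [measure_eq_zero_iff_ae_notMem.1 hsing.measure_compl_nullSet] with x hx
    simpa using hx
  have e3 : μ.variation = τ + μ.variation.restrict Sᶜ := by
    rw [← e2, Measure.restrict_add_restrict_compl hS]
  have e4 : τ ⟂ₘ μ.variation.restrict Sᶜ := by
    refine ⟨Sᶜ, hS.compl, hsing.measure_compl_nullSet, ?_⟩
    rw [compl_compl, Measure.restrict_apply hS, Set.inter_compl_self, measure_empty]
  rw [e3]
  filter_upwards [Measure.rnDeriv_add_right_of_mutuallySingular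
      (μ := lam.toJordanDecomposition.posPart) e4,
    Measure.rnDeriv_add_right_of_mutuallySingular
      (μ := lam.toJordanDecomposition.negPart) e4] with x h1 h2
  rw [SignedMeasure.rnDeriv_def, SignedMeasure.rnDeriv_def]
  simp only [h1, h2]

/-! ### Densities and real-valued area -/

theorem density_withDensityᵥ_volume {u : Ω → Eu N} (hu : Integrable u) :
    density ((volume : Measure Ω).withDensityᵥ u) volume =ᵐ[volume] u := by
  have h := withDensityᵥ_density (μ := (volume : Measure Ω).withDensityᵥ u) (θ := volume)
    fun B hB h0 => by
      rw [withDensityᵥ_apply hu hB, Measure.restrict_eq_zero.2 h0, integral_zero_measure]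
  exact (integrable_density _ _).ae_eq_of_withDensityᵥ_eq hu h

theorem toReal_area (μ : VMeas Ω N) :
    (area μ).toReal = (∫ x : Ω, √(1 + ‖density μ volume x‖ ^ 2)) +
      (singularPart μ).variation.real Set.univ ∧ area μ ≠ ⊤ := by
  have hI : Integrable (fun x : Ω => √(1 + ‖density μ volume x‖ ^ 2)) := by
    have h := (integrable_const (1 : ℝ)).add (integrable_density μ (volume : Measure Ω)).norm
    refine h.mono' ?_ (Eventually.of_forall fun x => ?_)
    · exact (show Continuous fun z : Eu N => √(1 + ‖z‖ ^ 2) by fun_prop).comp_aestronglyMeasurable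
        (integrable_density μ (volume : Measure Ω)).1
    · rw [Real.norm_of_nonneg (Real.sqrt_nonneg _)]
      refine Real.sqrt_le_iff.2 ⟨by simp only [Pi.add_apply]; positivity, ?_⟩
      simp only [Pi.add_apply]
      nlinarith [norm_nonneg (density μ volume x)]
  have e : ∫⁻ x : Ω, ENNReal.ofReal √(1 + ‖density μ volume x‖ ^ 2) =
      ENNReal.ofReal (∫ x : Ω, √(1 + ‖density μ volume x‖ ^ 2)) :=
    (ofReal_integral_eq_lintegral_ofReal hI (Eventually.of_forall fun x => Real.sqrt_nonneg _)).symm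
  constructor
  · rw [area, e, ENNReal.toReal_add ENNReal.ofReal_ne_top (measure_ne_top _ _),
      ENNReal.toReal_ofReal (integral_nonneg fun x => Real.sqrt_nonneg _)]
    rfl
  · rw [area, e]
    exact ENNReal.add_ne_top.2 ⟨ENNReal.ofReal_ne_top, measure_ne_top _ _⟩

theorem toReal_area_withDensityᵥ {u : Ω → Eu N} (hu : Integrable u) :
    (area ((volume : Measure Ω).withDensityᵥ u)).toReal = ∫ x : Ω, √(1 + ‖u x‖ ^ 2) := by
  have h := density_withDensityᵥ_volume hu
  have h0 : singularPart ((volume : Measure Ω).withDensityᵥ u) = 0 := by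
    rw [singularPart, WithDensityᵥEq.congr_ae h, sub_self]
  rw [(toReal_area _).1, h0, VectorMeasure.variation_zero]
  rw [measureReal_zero_apply, add_zero]
  exact integral_congr_ae (h.mono fun x hx => by simp only [hx])

end Decomposition

/-! ### Integrands -/

section Integrand

variable {d N : ℕ} {Ω : TopologicalSpace.Opens (Eu d)} {f : Ω → Eu N → ℝ}

theorem tendsto_recession_ray (hf : IsIntegrand f) (x : Ω) (z : Eu N) :
    Tendsto (fun t : ℝ => f x (t • z) / t) atTop (𝓝 (recession f x z)) :=
  (tendsto_recession hf x z).comp (tendsto_const_nhds.prodMk tendsto_id)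

theorem tendsto_affine_div (c z : ℝ) :
    Tendsto (fun t : ℝ => c * (1 + t * z) / t) atTop (𝓝 (c * z)) := by
  have h : Tendsto (fun t : ℝ => c / t + c * z) atTop (𝓝 (0 + c * z)) :=
    (tendsto_const_nhds.div_atTop tendsto_id).add_const _
  rw [zero_add] at h
  refine h.congr' ?_
  filter_upwards [eventually_gt_atTop (0 : ℝ)] with t ht
  field_simp

/-- The recession function is positively homogeneous, Lipschitz in `z`, and continuous. -/
theorem IsIntegrand.exists_isHomogLipschitz_recession (hf : IsIntegrand f) :
    ∃ M, 0 ≤ M ∧ IsHomogLipschitz M (recession f) := by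
  obtain ⟨M, hM, hg⟩ := hf.growth
  obtain ⟨k, hk, hmod⟩ := hf.modulus
  have hsmul : ∀ x (t : ℝ) z, 0 ≤ t → recession f x (t • z) = t * recession f x z := by
    intro x t z ht
    rcases ht.eq_or_lt with rfl | ht
    · rw [zero_smul, zero_mul]
      refine tendsto_nhds_unique (tendsto_recession_ray hf x 0) ?_
      simp only [smul_zero]
      exact tendsto_const_nhds.div_atTop tendsto_id
    · refine tendsto_nhds_unique (tendsto_recession_ray hf x (t • z)) ?_
      have h := ((tendsto_recession_ray hf x z).comp
        (tendsto_id.atTop_mul_const ht)).const_mul t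
      refine h.congr' ?_
      filter_upwards [eventually_gt_atTop (0 : ℝ)] with r hr
      simp only [Function.comp_apply, id, smul_smul]
      field_simp
  have hle : ∀ x z, recession f x z ≤ M * ‖z‖ := by
    intro x z
    refine le_of_tendsto_of_tendsto (tendsto_recession_ray hf x z) (tendsto_affine_div M ‖z‖) ?_
    filter_upwards [eventually_gt_atTop (0 : ℝ)] with t ht
    have := (le_abs_self _).trans (hg x (t • z)).2
    rw [norm_smul, Real.norm_of_nonneg ht.le] at this
    gcongr
  have hadd : ∀ x z z', recession f x (z + z') ≤ recession f x z + recession f x z' := by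
    intro x z z'
    -- Midpoint convexity bounds `f x (t • (z + z'))` by values at `(2t) • z` and `(2t) • z'`, so
    -- the limits on the right are taken along `2t`.
    have h2 : Tendsto (fun t : ℝ => t * 2) atTop atTop := tendsto_id.atTop_mul_const two_pos
    refine le_of_tendsto_of_tendsto (tendsto_recession_ray hf x (z + z'))
      (((tendsto_recession_ray hf x z).comp h2).add ((tendsto_recession_ray hf x z').comp h2)) ?_
    filter_upwards [eventually_gt_atTop (0 : ℝ)] with t ht
    have hc := (hf.convex x).2 (Set.mem_univ ((t * 2) • z)) (Set.mem_univ ((t * 2) • z'))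
      (show (0 : ℝ) ≤ 1 / 2 by norm_num) (show (0 : ℝ) ≤ 1 / 2 by norm_num) (by norm_num)
    rw [smul_smul, smul_smul, show 1 / 2 * (t * 2) = t by ring, ← smul_add] at hc
    simp only [smul_eq_mul] at hc
    simp only [Function.comp_apply]
    rw [← add_div, div_le_div_iff₀ ht (by positivity)]
    nlinarith
  -- A subadditive function bounded above by `M * ‖z‖` is `M`-Lipschitz.
  have hlip : ∀ x z z', |recession f x z - recession f x z'| ≤ M * ‖z - z'‖ := by
    intro x z z'
    have h1 := hadd x z' (z - z')
    have h2 := hadd x z (z' - z)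
    have h3 := hle x (z' - z)
    rw [norm_sub_rev] at h3
    rw [add_sub_cancel] at h1 h2
    rw [abs_le]
    constructor <;> linarith [hle x (z - z')]
  have hx : ∀ x y z, |recession f x z - recession f y z| ≤ k (dist x y) * ‖z‖ := by
    intro x y z
    refine le_of_tendsto_of_tendsto ((tendsto_recession_ray hf x z).sub
      (tendsto_recession_ray hf y z)).abs (tendsto_affine_div (k (dist x y)) ‖z‖) ?_
    filter_upwards [eventually_gt_atTop (0 : ℝ)] with t ht
    have := hmod x y (t • z)
    rw [norm_smul, Real.norm_of_nonneg ht.le] at this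
    rw [← sub_div, abs_div, abs_of_pos ht]
    gcongr
  refine ⟨M, hM.le, ⟨?_, hsmul, hlip⟩⟩
  rw [continuous_iff_continuousAt]
  rintro ⟨x₀, z₀⟩
  rw [ContinuousAt, tendsto_iff_dist_tendsto_zero]
  have hd : Tendsto (fun p : Ω × Eu N => k (dist p.1 x₀)) (𝓝 (x₀, z₀)) (𝓝 0) := by
    refine hk.comp (tendsto_nhdsWithin_iff.2 ⟨?_, Eventually.of_forall fun _ => dist_nonneg⟩)
    exact (continuous_fst.dist continuous_const).tendsto' _ _ (dist_self x₀)
  have hz : Tendsto (fun p : Ω × Eu N => ‖p.2 - z₀‖) (𝓝 (x₀, z₀)) (𝓝 0) :=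
    (continuous_snd.sub continuous_const).norm.tendsto' _ _ (by simp)
  have hb := (hz.const_mul M).add (hd.mul_const ‖z₀‖)
  rw [mul_zero, zero_mul, add_zero] at hb
  refine squeeze_zero (fun _ => dist_nonneg) (fun p => ?_) hb
  rw [Real.dist_eq]
  exact (abs_sub_le _ (recession f p.1 z₀) _).trans (add_le_add (hlip _ _ _) (hx _ _ _))

theorem coe_le_conjugate (f : Ω → Eu N → ℝ) (x : Ω) (v z : Eu N) :
    ((⟪v, z⟫ - f x z : ℝ) : EReal) ≤ conjugate f x v :=
  le_iSup (fun z : Eu N => ((⟪v, z⟫ - f x z : ℝ) : EReal)) z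

/-- Fenchel's inequality at `t • z` costs the constant `f*(x, v)`, which is negligible after
division by `t → ∞`. -/
theorem inner_le_recession (hf : IsIntegrand f) {x : Ω} {v : Eu N} (h : conjugate f x v ≠ ⊤)
    (z : Eu N) : ⟪z, v⟫ ≤ recession f x z := by
  have hbot : conjugate f x v ≠ ⊥ := by
    refine ne_of_gt (lt_of_lt_of_le (EReal.bot_lt_coe (⟪v, 0⟫ - f x 0)) ?_)
    exact coe_le_conjugate f x v 0
  set c := (conjugate f x v).toReal
  have hc : ∀ z : Eu N, ⟪v, z⟫ - f x z ≤ c := by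
    intro z
    rw [← EReal.coe_le_coe_iff, EReal.coe_toReal h hbot]
    exact coe_le_conjugate f x v z
  have ht : Tendsto (fun t : ℝ => f x (t • z) / t + c / t) atTop (𝓝 (recession f x z + 0)) :=
    (tendsto_recession_ray hf x z).add (tendsto_const_nhds.div_atTop tendsto_id)
  rw [add_zero] at ht
  refine ge_of_tendsto ht ?_
  filter_upwards [eventually_gt_atTop (0 : ℝ)] with t ht
  have := hc (t • z)
  rw [inner_smul_right, real_inner_comm] at this
  rw [← add_div, le_div_iff₀ ht]
  linarith

theorem measurable_conjugate (hf : IsIntegrand f) :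
    Measurable fun p : Ω × Eu N => conjugate f p.1 p.2 := by
  refine LowerSemicontinuous.measurable (lowerSemicontinuous_iSup fun z => ?_)
  refine Continuous.lowerSemicontinuous (continuous_coe_real_ereal.comp ?_)
  exact (continuous_snd.inner continuous_const).sub
    (hf.continuous.comp (continuous_fst.prodMk continuous_const))

theorem ae_ne_top_of_lintegral_toENNReal_ne_top {X Y : Type*} [MeasurableSpace X]
    [MeasurableSpace Y] {m : Measure X} {g : X × Y → EReal} (hg : Measurable g) {v : X → Y}
    (hv : AEMeasurable v m) (h : ∫⁻ x, (g (x, v x)).toENNReal ∂m ≠ ⊤) :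
    ∀ᵐ x ∂m, g (x, v x) ≠ ⊤ := by
  have hm : AEMeasurable (fun x => (g (x, v x)).toENNReal) m :=
    (measurable_ereal_toENNReal.comp hg).comp_aemeasurable (aemeasurable_id'.prodMk hv)
  refine (ae_lt_top' hm h).mono fun x hx htop => ?_
  rw [htop, EReal.toENNReal_top] at hx
  exact lt_irrefl _ hx

theorem ae_conjugate_ne_top [IsFiniteMeasure (volume : Measure Ω)] (hf : IsIntegrand f)
    {v : Ω → Eu N} (hv : AEMeasurable v) (h : eintegral (fun x => conjugate f x (v x)) ≠ ⊤) :
    ∀ᵐ x : Ω, conjugate f x (v x) ≠ ⊤ := by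
  obtain ⟨M, hM, hg⟩ := hf.growth
  -- Testing with `z = 0` gives `f* ≥ -f(x, 0) ≥ -M` on a space of finite measure. No `⊤ - ⊤` can
  -- therefore occur, and an infinite positive part would make `eintegral` equal to `⊤`.
  have hneg : ∫⁻ x : Ω, (-conjugate f x (v x)).toENNReal ≠ ⊤ := by
    have hle : ∀ x : Ω, (-conjugate f x (v x)).toENNReal ≤ ENNReal.ofReal M := by
      intro x
      have h2 : -conjugate f x (v x) ≤ ((M : ℝ) : EReal) := by
        refine (EReal.neg_le_neg_iff.2 (coe_le_conjugate f x (v x) 0)).trans ?_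
        rw [← EReal.coe_neg, EReal.coe_le_coe_iff]
        have := (le_abs_self _).trans (hg x 0).2
        rw [norm_zero] at this
        rw [inner_zero_right]
        linarith
      have := EReal.toENNReal_le_toENNReal h2
      rwa [EReal.toENNReal_of_ne_top (EReal.coe_ne_top M), EReal.toReal_coe] at this
    refine ((lintegral_mono hle).trans_lt ?_).ne
    rw [lintegral_const]
    exact ENNReal.mul_lt_top ENNReal.ofReal_lt_top (measure_lt_top _ _)
  have hpos : ∫⁻ x : Ω, (conjugate f x (v x)).toENNReal ≠ ⊤ := by
    intro htop
    refine h ?_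
    unfold eintegral
    rw [htop, EReal.coe_ennreal_top]
    lift (∫⁻ x : Ω, (-conjugate f x (v x)).toENNReal) to NNReal using hneg with r
    exact EReal.top_sub_coe r
  exact ae_ne_top_of_lintegral_toENNReal_ne_top (measurable_conjugate hf) hv hpos

end Integrand

/-! ### The generalized pairing -/

section Pairing

variable {d N : ℕ} {Ω : TopologicalSpace.Opens (Eu d)}

theorem isHomogLipschitz_const_mul_norm {X F : Type*} [TopologicalSpace X] [NormedAddCommGroup F]
    [NormedSpace ℝ F] {D : ℝ} (hD : 0 ≤ D) : IsHomogLipschitz D fun (_ : X) (z : F) => D * ‖z‖ where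
  continuous := by fun_prop
  smul x t z ht := by
    rw [norm_smul, Real.norm_of_nonneg ht]
    ring
  lipschitz x z z' := by
    rw [← mul_sub, abs_mul, abs_of_nonneg hD]
    exact mul_le_mul_of_nonneg_left (abs_norm_sub_norm_le z z') hD

theorem ae_norm_le_of_Linfty (v : Linfty Ω N) : ∃ D, 0 ≤ D ∧ ∀ᵐ x : Ω, ‖v x‖ ≤ D := by
  refine ⟨(eLpNormEssSup v volume).toReal, ENNReal.toReal_nonneg, ?_⟩
  have hlt : eLpNormEssSup v volume < ⊤ := by
    have := (Lp.memLp v).2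
    rwa [eLpNorm_exponent_top] at this
  filter_upwards [ae_le_eLpNormEssSup (f := v) (μ := volume)] with x hx
  have := ENNReal.toReal_mono hlt.ne hx
  rwa [toReal_enorm] at this

theorem WeakStar.tendsto_of_hasCompactSupport {F : Type*} [NormedAddCommGroup F] [NormedSpace ℝ F]
    {ν : ℕ → VectorMeasure Ω F} {μ : VectorMeasure Ω F} (h : WeakStar ν μ) {φ : Ω → ℝ}
    (hφ : Continuous φ) (hφs : HasCompactSupport φ) :
    Tendsto (fun j => ∫ᵛ x, φ x ∂•(ν j)) atTop (𝓝 (∫ᵛ x, φ x ∂•μ)) :=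
  h ⟨⟨φ, hφ⟩, hφs.is_zero_at_infty⟩

theorem integrable_of_hasCompactSupport {θ : Measure Ω} [IsFiniteMeasure θ]
    {F : Type*} [NormedAddCommGroup F] {φ : Ω → F} (hφ : Continuous φ)
    (hφs : HasCompactSupport φ) : Integrable φ θ := by
  obtain ⟨C, hC⟩ := hφs.exists_bound_of_continuous hφ
  exact Integrable.of_bound hφ.aestronglyMeasurable C (Eventually.of_forall hC)

theorem isFiniteMeasure_variation_withDensityᵥ {F : Type*} [NormedAddCommGroup F] [NormedSpace ℝ F]
    [CompleteSpace F] {θ : Measure Ω} {h : Ω → F} (hh : Integrable h θ) :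
    IsFiniteMeasure (θ.withDensityᵥ h).variation := by
  rw [Measure.variation_withDensityᵥ hh]
  exact isFiniteMeasure_withDensity hh.2.ne

/-- `WeakStar` uses scalar test functions; vector-valued ones are recovered coordinate by
coordinate. -/
theorem integral_inner_eq_sum {θ : Measure Ω} [IsFiniteMeasure θ] {h : Ω → Eu N}
    (hh : Integrable h θ) {Ψ : Ω → Eu N} (hΨ : Continuous Ψ) (hΨs : HasCompactSupport Ψ) :
    ∫ x, ⟪Ψ x, h x⟫ ∂θ = ∑ i, (∫ᵛ x, Ψ x i ∂•(θ.withDensityᵥ h)) i := by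
  have hc : ∀ i, Continuous fun x => Ψ x i := fun i =>
    (EuclideanSpace.proj i : Eu N →L[ℝ] ℝ).continuous.comp hΨ
  have hs : ∀ i, HasCompactSupport fun x => Ψ x i := fun i =>
    hΨs.comp_left (g := fun z : Eu N => z i) rfl
  have hi : ∀ i j, Integrable (fun x => Ψ x i * h x j) θ := fun i j => by
    obtain ⟨C, hC⟩ := (hs i).exists_bound_of_continuous (hc i)
    exact (hh.eval_piLp j).bdd_mul (hc i).aestronglyMeasurable (Eventually.of_forall hC)
  have := isFiniteMeasure_variation_withDensityᵥ hh
  have e : ∀ x, ⟪Ψ x, h x⟫ = ∑ i, Ψ x i * h x i := fun x => by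
    simp [PiLp.inner_apply, mul_comm]
  simp only [e]
  rw [integral_finsetSum _ fun i _ => hi i i]
  refine Finset.sum_congr rfl fun i _ => ?_
  rw [integral_withDensityᵥ hh (integrable_of_hasCompactSupport (hc i) (hs i)),
    eval_integral_piLp fun j => hi i j]
  rfl

theorem integral_eq_density_add_singularPart (μ : VMeas Ω N) {φ : Ω → ℝ} (hφ : Continuous φ)
    (hφs : HasCompactSupport φ) :
    ∫ᵛ x, φ x ∂•μ = ∫ᵛ x, φ x ∂•((volume : Measure Ω).withDensityᵥ (density μ volume)) +
      ∫ᵛ x, φ x ∂•(singularPart μ) := by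
  have := isFiniteMeasure_variation_withDensityᵥ (integrable_density μ (volume : Measure Ω))
  rw [← VectorMeasure.integral_add_vectorMeasure (integrable_of_hasCompactSupport hφ hφs)
    (integrable_of_hasCompactSupport hφ hφs), singularPart, add_sub_cancel]

theorem WeakStar.neg {F : Type*} [NormedAddCommGroup F] [NormedSpace ℝ F]
    {ν : ℕ → VectorMeasure Ω F} {μ : VectorMeasure Ω F} (h : WeakStar ν μ) :
    WeakStar (fun j => -ν j) (-μ) := by
  intro φ
  simp only [VectorMeasure.integral_neg_vectorMeasure]
  exact (h φ).neg

variable [IsFiniteMeasure (volume : Measure Ω)]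

/-- If `v(x) · z ≤ G(x, z)`, then every element of `⟦μ, v⟧` is bounded from above by
`(dμ/d𝓛ᵈ · v) 𝓛ᵈ + G(x, dμ/d|μˢ|) |μˢ|`. -/
theorem apply_le_of_areaStrict {u : ℕ → Ω → Eu N} (hu : ∀ j, Integrable (u j)) {μ : VMeas Ω N}
    (hstrict : AreaStrict (fun j => (volume : Measure Ω).withDensityᵥ (u j)) μ)
    {v : Ω → Eu N} (hv : AEStronglyMeasurable v) {D : ℝ} (hvD : ∀ᵐ x : Ω, ‖v x‖ ≤ D)
    {lam : SignedMeasure Ω}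
    (hlam : WeakStar (fun j => (volume : Measure Ω).withDensityᵥ fun x => ⟪u j x, v x⟫) lam)
    {K : ℝ} (hK : 0 ≤ K) {G : Ω → Eu N → ℝ} (hG : IsHomogLipschitz K G)
    (hvG : ∀ᵐ x : Ω, ∀ z, ⟪z, v x⟫ ≤ G x z) {B : Set Ω} (hB : MeasurableSet B) :
    lam B ≤ ∫ x in B, ⟪density μ volume x, v x⟫ ∂volume +
      ∫ x in B, G x (density (singularPart μ) (singularPart μ).variation x)
        ∂(singularPart μ).variation := by
  have : LocallyCompactSpace Ω := Ω.isOpen.locallyCompactSpace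
  set τ := (singularPart μ).variation
  set a := density μ volume
  set s := density (singularPart μ) τ
  have ha : Integrable a := integrable_density _ _
  have hs : Integrable s τ := integrable_density _ _
  have hpolar : τ.withDensityᵥ s = singularPart μ := withDensityᵥ_density_variation _
  have hpair : ∀ {V : Ω → Eu N}, Integrable V → Integrable (fun x => ⟪V x, v x⟫) := by
    intro V hV
    refine (hV.norm.const_mul D).mono' (hV.1.inner hv) (hvD.mono fun x hx => ?_)
    refine (norm_inner_le_norm _ _).trans ?_
    rw [mul_comm]
    exact mul_le_mul_of_nonneg_right hx (norm_nonneg _)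
  have hGs : Integrable (fun x => G x (s x)) τ := hG.integrable hs
  have hweak : ∀ Ψ : Ω → Eu N, Continuous Ψ → HasCompactSupport Ψ →
      Tendsto (fun j => ∫ x, ⟪Ψ x, u j x⟫) atTop
        (𝓝 (∫ x, ⟪Ψ x, a x⟫ ∂volume + ∫ x, ⟪Ψ x, s x⟫ ∂τ)) := by
    intro Ψ hΨ hΨs
    simp only [integral_inner_eq_sum (hu _) hΨ hΨs]
    rw [integral_inner_eq_sum ha hΨ hΨs, integral_inner_eq_sum hs hΨ hΨs, hpolar,
      ← Finset.sum_add_distrib]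
    refine tendsto_finsetSum _ fun i _ => ?_
    have hc : Continuous fun x => Ψ x i :=
      (EuclideanSpace.proj i : Eu N →L[ℝ] ℝ).continuous.comp hΨ
    have hcs : HasCompactSupport fun x => Ψ x i := hΨs.comp_left (g := fun z : Eu N => z i) rfl
    have h := hstrict.1.tendsto_of_hasCompactSupport hc hcs
    rw [integral_eq_density_add_singularPart μ hc hcs] at h
    exact ((EuclideanSpace.proj i : Eu N →L[ℝ] ℝ).continuous.tendsto _).comp h
  have harea : Tendsto (fun j => ∫ x, √(1 + ‖u j x‖ ^ 2)) atTop
      (𝓝 (∫ x, √(1 + ‖a x‖ ^ 2) ∂volume + τ.real Set.univ)) := by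
    have h := (ENNReal.tendsto_toReal (toReal_area μ).2).comp hstrict.2
    rw [(toReal_area μ).1] at h
    exact h.congr fun j => toReal_area_withDensityᵥ (hu j)
  have hbound : ∀ φ : Ω → ℝ, Continuous φ → HasCompactSupport φ → (∀ x, 0 ≤ φ x) →
      ∫ᵛ x, φ x ∂•lam ≤ ∫ x, φ x * ⟪a x, v x⟫ ∂volume + ∫ x, φ x * G x (s x) ∂τ := by
    intro φ hφ hφs hφ0
    refine le_of_areaStrict (mutuallySingular_variation_singularPart μ) hu ha hs
      (norm_density_variation _) hweak harea hG hK hv hvD hvG hφ hφs hφ0 ?_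
    refine (hlam.tendsto_of_hasCompactSupport hφ hφs).congr fun j => ?_
    exact integral_withDensityᵥ (hpair (hu j)) (integrable_of_hasCompactSupport hφ hφs)
  set ρ₁ : SignedMeasure Ω := (volume : Measure Ω).withDensityᵥ fun x => ⟪a x, v x⟫
  set ρ₂ : SignedMeasure Ω := τ.withDensityᵥ fun x => G x (s x)
  -- The inequality on nonnegative test functions becomes one between measures.
  have hle : (lam - (ρ₁ + ρ₂)) B ≤ 0 := by
    refine signedMeasure_apply_le_zero (fun φ hφ hφs hφ0 => ?_) hB
    have hi : ∀ ν : SignedMeasure Ω, Integrable φ ν.variation := fun ν =>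
      integrable_of_hasCompactSupport hφ hφs
    rw [VectorMeasure.integral_sub_vectorMeasure (hi _) (hi _),
      VectorMeasure.integral_add_vectorMeasure (hi _) (hi _),
      integral_withDensityᵥ (hpair ha) (hi _), integral_withDensityᵥ hGs (hi _)]
    simpa using hbound φ hφ hφs hφ0
  rw [_root_.sub_apply, _root_.add_apply, withDensityᵥ_apply (hpair ha) hB,
    withDensityᵥ_apply hGs hB] at hle
  linarith

end Pairing

end LinearGrowth

/-! ### Densities of the generalized pairing -/

theorem theorem4p3 {d N n : ℕ} (Ω : TopologicalSpace.Opens (LinearGrowth.Eu d))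
    (hΩ : volume (Ω : Set (LinearGrowth.Eu d)) ≠ ⊤)
    (A : LinearGrowth.PDO Ω N n)
    (f : Ω → LinearGrowth.Eu N → ℝ) (hf : LinearGrowth.IsIntegrand f)
    (u₀ : LinearGrowth.L1 Ω N) (τ : LinearGrowth.L1 Ω n) (hτ : A.Maps u₀ τ)
    (μ : LinearGrowth.VMeas Ω N) (hμ : μ ∈ A.affineKerM u₀)
    (w : LinearGrowth.Linfty Ω n) (hw : w ∈ A.adjointDomain)
    (hR : ⊥ < LinearGrowth.dualFunctional A f τ w)
    (lam : SignedMeasure Ω) (hlam : lam ∈ LinearGrowth.pairing A u₀ μ (A.adjoint w)) :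
    (∀ᵐ x ∂(LinearGrowth.singularPart μ).variation,
      lam.rnDeriv μ.variation x = lam.rnDeriv (LinearGrowth.singularPart μ).variation x ∧
      lam.rnDeriv (LinearGrowth.singularPart μ).variation x ≤
        LinearGrowth.recession f x
          (LinearGrowth.density μ (LinearGrowth.singularPart μ).variation x)) ∧
    (∀ᵐ x : Ω, lam.rnDeriv volume x =
      ⟪LinearGrowth.density μ volume x, A.adjoint w x⟫) := by
  have : IsFiniteMeasure (volume : Measure Ω) :=
    ⟨by rw [Measure.Subtype.volume_univ Ω.isOpen.measurableSet.nullMeasurableSet]; exact hΩ.lt_top⟩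
  obtain ⟨u, -, hstrict, hpair⟩ := hlam
  set v := A.adjoint w
  set τs := (LinearGrowth.singularPart μ).variation
  set s := LinearGrowth.density (LinearGrowth.singularPart μ) τs
  have hu : ∀ j, Integrable (u j) := fun j => L1.integrable_coeFn (u j)
  have hv : AEStronglyMeasurable v volume := Lp.aestronglyMeasurable v
  obtain ⟨D, hD, hvD⟩ := LinearGrowth.ae_norm_le_of_Linfty v
  obtain ⟨M, hM, hrec⟩ := hf.exists_isHomogLipschitz_recession
  have hsτ : Integrable s τs := LinearGrowth.integrable_density _ _
  have hs1 : ∀ᵐ x ∂τs, ‖s x‖ = 1 := LinearGrowth.norm_density_variation _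
  have hconj : LinearGrowth.eintegral (fun x => LinearGrowth.conjugate f x (v x)) ≠ ⊤ := by
    intro htop
    rw [LinearGrowth.dualFunctional, if_pos hw, htop, EReal.sub_top] at hR
    exact lt_irrefl _ hR
  have hdom : ∀ᵐ x : Ω, ∀ z, ⟪z, v x⟫ ≤ LinearGrowth.recession f x z :=
    (LinearGrowth.ae_conjugate_ne_top hf hv.aemeasurable hconj).mono
      fun x hx => LinearGrowth.inner_le_recession hf hx
  have hnorm : ∀ᵐ x : Ω, ∀ z, ⟪z, v x⟫ ≤ D * ‖z‖ := hvD.mono fun x hx z => by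
    refine (real_inner_le_norm _ _).trans ?_
    rw [mul_comm]
    exact mul_le_mul_of_nonneg_right hx (norm_nonneg z)
  have hnorm' : ∀ᵐ x : Ω, ∀ z, ⟪z, (-v : Ω → LinearGrowth.Eu N) x⟫ ≤ D * ‖z‖ :=
    hnorm.mono fun x hx z => by
      have := hx (-z)
      rwa [norm_neg, inner_neg_left, ← inner_neg_right] at this
  -- The pairing is odd in `v`, so an upper bound for `-lam` is a lower bound for `lam`. The norm
  -- integrand `D * ‖z‖` dominates both signs, whereas `f^∞` need dominate only `v`.
  have hpair' : LinearGrowth.WeakStar (fun j => (volume : Measure Ω).withDensityᵥ fun x =>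
      ⟪u j x, (-v : Ω → LinearGrowth.Eu N) x⟫) (-lam) := by
    refine (funext fun j => ?_ : (fun j => (volume : Measure Ω).withDensityᵥ fun x =>
      ⟪u j x, (-v : Ω → LinearGrowth.Eu N) x⟫) = _) ▸ hpair.neg
    rw [← withDensityᵥ_neg']
    simp only [Pi.neg_apply, inner_neg_right]
  have hup := fun B hB => LinearGrowth.apply_le_of_areaStrict hu hstrict hv hvD hpair hM hrec
    hdom (B := B) hB
  have hup1 := fun B hB => LinearGrowth.apply_le_of_areaStrict hu hstrict hv hvD hpair hD
    (LinearGrowth.isHomogLipschitz_const_mul_norm hD) hnorm (B := B) hB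
  have hup2 := fun B hB => LinearGrowth.apply_le_of_areaStrict hu hstrict hv.neg
    (hvD.mono fun x hx => by simpa using hx) hpair' hD
    (LinearGrowth.isHomogLipschitz_const_mul_norm hD) hnorm' (B := B) hB
  -- Since `s` has norm one, the bounds `hup1` and `hup2` involve exactly `D` times the variation of
  -- the singular part.
  have hmass : ∀ B : Set Ω, ∫ x in B, D * ‖s x‖ ∂τs = D * τs.real B := by
    intro B
    rw [integral_congr_ae (g := fun _ => D)
      ((ae_restrict_of_ae hs1).mono fun x hx => by simp [hx])]
    simp [mul_comm]
  have hp : Integrable (fun x : Ω => ⟪LinearGrowth.density μ volume x, v x⟫) := by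
    have ha := LinearGrowth.integrable_density μ (volume : Measure Ω)
    refine (ha.norm.const_mul D).mono' (ha.1.inner hv) (hvD.mono fun x hx => ?_)
    refine (norm_inner_le_norm _ _).trans ?_
    rw [mul_comm]
    exact mul_le_mul_of_nonneg_right hx (norm_nonneg _)
  obtain ⟨h1, h2⟩ := LinearGrowth.signedMeasure_rnDeriv_of_bounds (lam := lam)
    (LinearGrowth.mutuallySingular_variation_singularPart μ) hp (hrec.integrable hsτ) (C := D)
    hup fun B hB => by
      have e1 := hup1 B hB
      have e2 := hup2 B hB
      simp only [Pi.neg_apply, inner_neg_right, integral_neg, _root_.neg_apply] at e2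
      rw [hmass] at e1 e2
      rw [abs_le]
      constructor <;> linarith
  refine ⟨?_, h1⟩
  filter_upwards [LinearGrowth.rnDeriv_variation_ae_eq lam μ, h2,
    LinearGrowth.density_singularPart_ae_eq μ] with x hx1 hx2 hx3
  refine ⟨hx1, ?_⟩
  rw [hx3]
  exact hx2
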